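/- Let $\mathcal H$ be a complex Hilbert space (inner product antilinear in the first variable) and $H$ a self-adjoint operator on $\mathcal H$. Let $\mathcal H_{\rm ac},\mathcal H_{\rm sc}$ be the subspaces of vectors whose spectral measure with respect to $H$ is absolutely continuous, respectively singular and without atoms, let $\mathcal H_{\rm p}$ be the closed linear hull of the eigenvectors of $H$, and let $H_{\rm ac},H_{\rm sc},H_{\rm p}$ be the reduced parts of $H$. Assume that $H\in S_1(\mathcal H)$, that is: (H.1) $\sigma(H_{\rm sc})=\emptyset$; (H.2) $\sigma(H_{\rm ac})=[0,\infty)$; (H.3) $\sigma_{\rm disc}(H)=\sigma_{\rm p}(H)=\{E_n\}_{n=1}^\infty$ with $E_1<E_2<\cdots<0$ and $E_n\to0$, where $\sigma_{\rm p}(H)$ is the set of eigenvalues and $\sigma_{\rm disc}(H)$ the set of eigenvalues of finite multiplicity that are isolated points of $\sigma(H)$; (H.4) $H_{\rm ac}$ has a strong time operator, i.e. a densely defined symmetric operator $T$ on $\mathcal H_{\rm ac}$ with $e^{-itH_{\rm ac}}{\rm D}(T)\subset {\rm D}(T)$ and $Te^{-itH_{\rm ac}}\psi=e^{-itH_{\rm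 ac}}(T+t)\psi$ for all $\psi\in{\rm D}(T)$, $t\in\mathbb R$. A CCR-domain for $(H_{\rm ac},T)$ is a non-zero subspace of ${\rm D}(H_{\rm ac}T)\cap {\rm D}(TH_{\rm ac})$ on which $H_{\rm ac}T-TH_{\rm ac}=-i$. A sesquilinear form $\mathfrak t:\mathcal D_1\times\mathcal D_2\to\mathbb C$ on non-zero subspaces $\mathcal D_1,\mathcal D_2$ of $\mathcal H$ is an ultra-weak time operator of $H$, with ultra-weak CCR-domain $\mathscr E$, if $\mathscr E\neq\{0\}$ and there is a non-zero subspace $\mathcal D\subset\mathcal D_1\cap\mathcal D_2$ with $\mathscr E\subset {\rm D}(H)\cap\mathcal D$, $\mathfrak t[\phi,\psi]^*=\mathfrak t[\psi,\phi]$ for $\phi,\psi\in\mathcal D$, $H\mathscr E\subset\mathcal D_1$, and $\mathfrak t[H\phi,\psi]-\mathfrak t[H\psi,\phi]^*=-i(\phi,\psi)$ for $\phi,\psi\in\mathscr E$. Then the following hold. (a) $H_{\rm ac}$ has a closed strong time operator, and every closed strong time operator of $H_{\rm ac}$ has a CCR-domain that is dense in $\mathcal H_{\rm ac}$. (b) There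 are $N\le\infty$ and an orthonormal family $(e^j_n)_{j\le N,\,n\in\mathbb N}$ whose closed linear hull is $\mathcal H_{\rm p}$, with $He_n^j=F_{jn}e_n^j$, where for each $j$ the numbers $F_{jn}$ ($n\in\mathbb N$) are distinct and $\sum_nF_{jn}^2<\infty$. (c) Let $T_{\rm ac}$ be any strong time operator of $H_{\rm ac}$ that has a dense CCR-domain $\mathcal D_{\rm ac}$, and let $(e_n^j)$ be any family as in (b). Let $\mathcal H_j$ be the closed linear hull of $\{e_n^j\}_n$, $H_j$ the part of $H$ in $\mathcal H_j$, ${\rm D}(S_j)$ the linear hull of $\{e_n^j\}_n$, $$S_j\phi=i\sum_n\Big(\sum_{m\ne n}\frac{(e_m^j,\phi)}{1/F_{jn}-1/F_{jm}}\Big)e_n^j,\qquad \mathfrak t_j[\phi,\psi]=-\tfrac12\{(S_j\phi,H_j^{-2}\psi)+(H_j^{-2}\phi,S_j\psi)\}\qquad(\phi,\psi\in {\rm D}(S_j)),$$ let $\mathcal D_{\rm p}$ be the algebraic direct sum of the ${\rm D}(S_j)$, $\mathfrak t_{\rm p}[\phi,\psi]=\sum_j\mathfrak t_j[\phi_j,\psi_j]$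 on $\mathcal D_{\rm p}\times\mathcal D_{\rm p}$, and $\mathscr E_{\rm p}$ the linear hull of all $e^j_n-e^j_m$ ($j\le N$, $n,m\in\mathbb N$). Then the form $\mathfrak t_H:(\mathcal H_{\rm ac}\oplus\mathcal D_{\rm p})\times({\rm D}(T_{\rm ac})\oplus\mathcal D_{\rm p})\to\mathbb C$, $$\mathfrak t_H[\phi_1\oplus\phi_2,\psi_1\oplus\psi_2]=(\phi_1,T_{\rm ac}\psi_1)+\mathfrak t_{\rm p}[\phi_2,\psi_2],$$ is well defined and is an ultra-weak time operator of $H$; $\mathcal D_{\rm ac}\oplus H_{\rm p}^{-1}\mathscr E_{\rm p}$ is an ultra-weak CCR-domain for $(H,\mathfrak t_H)$, and $\mathcal D_{\rm ac}\oplus H_{\rm p}\mathscr E_{\rm p}$ is an ultra-weak CCR-domain for $(H,\mathfrak t_H)$ that is dense in $\mathcal H$. -/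

import Mathlib

open MeasureTheory
open scoped ComplexConjugate

noncomputable section

namespace TimeOperator

/-! ### Unbounded operators: value, spectrum, eigenvalues, reduced parts -/

section Operators

variable {E : Type*} [NormedAddCommGroup E] [InnerProductSpace ℂ E]

open scoped Classical in
/-- The value `A x` of an operator at a vector of its domain, and `0` outside the domain. -/
def value (A : E →ₗ.[ℂ] E) (x : E) : E :=
  if h : x ∈ A.domain then A ⟨x, h⟩ else 0

/-- The resolvent set: all `z` for which `A - z : D(A) → E` is a bijection with bounded inverse. -/
def resolventSet (A : E →ₗ.[ℂ] E) : Set ℂ :=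
  {z | ∃ R : E →L[ℂ] E,
    (∀ x : E, ∃ h : R x ∈ A.domain, A ⟨R x, h⟩ - z • R x = x) ∧
    ∀ x : A.domain, R (A x - z • (x : E)) = x}

/-- The spectrum `σ(A)`. -/
def spectrum (A : E →ₗ.[ℂ] E) : Set ℂ := (resolventSet A)ᶜ

/-- The eigenspace `ker (A - z)`, as a subspace of `E`. -/
def eigenspace (A : E →ₗ.[ℂ] E) (z : ℂ) : Submodule ℂ E :=
  (LinearMap.ker (A.toFun - z • A.domain.subtype)).map A.domain.subtype

/-- The set `σ_p(A)` of all eigenvalues. -/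
def pointSpectrum (A : E →ₗ.[ℂ] E) : Set ℂ := {z | eigenspace A z ≠ ⊥}

/-- The discrete spectrum `σ_disc(A)`: the eigenvalues of finite multiplicity that are isolated
points of the spectrum. -/
def discreteSpectrum (A : E →ₗ.[ℂ] E) : Set ℂ :=
  {z | z ∈ pointSpectrum A ∧ FiniteDimensional ℂ (eigenspace A z) ∧
    ∃ ε > 0, spectrum A ∩ Metric.ball z ε ⊆ {z}}

/-- The part of `A` in the subspace `K`, as an operator on the space `K`, with domain
`{x ∈ K ∩ D(A) | A x ∈ K}`.  If `K` reduces `A`, this is the reduced part of `A` to `K`. -/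
def reducedPart (A : E →ₗ.[ℂ] E) (K : Submodule ℂ E) : K →ₗ.[ℂ] K where
  domain :=
    { carrier := {x | ∃ h : (x : E) ∈ A.domain, A ⟨x, h⟩ ∈ K}
      zero_mem' := ⟨A.domain.zero_mem, by
        have : A ⟨0, A.domain.zero_mem⟩ = 0 := A.map_zero
        simp [this]⟩
      add_mem' := by
        rintro x y ⟨hx, hx'⟩ ⟨hy, hy'⟩
        refine ⟨A.domain.add_mem hx hy, ?_⟩
        have : A ⟨(x : E) + y, A.domain.add_mem hx hy⟩ = A ⟨x, hx⟩ + A ⟨y, hy⟩ :=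
          A.map_add ⟨x, hx⟩ ⟨y, hy⟩
        exact this ▸ K.add_mem hx' hy'
      smul_mem' := by
        rintro c x ⟨hx, hx'⟩
        refine ⟨A.domain.smul_mem c hx, ?_⟩
        have : A ⟨c • (x : E), A.domain.smul_mem c hx⟩ = c • A ⟨x, hx⟩ :=
          A.map_smul c ⟨x, hx⟩
        exact this ▸ K.smul_mem c hx' }
  toFun :=
    { toFun := fun x => ⟨A ⟨x.1, x.2.choose⟩, x.2.choose_spec⟩
      map_add' := fun x y =>
        Subtype.ext (A.map_add ⟨x.1, x.2.choose⟩ ⟨y.1, y.2.choose⟩)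
      map_smul' := fun c x => Subtype.ext (A.map_smul c ⟨x.1, x.2.choose⟩) }

end Operators

/-! ### Spectral subspaces of a self-adjoint operator -/

section Spectral

variable {E : Type*} [NormedAddCommGroup E] [InnerProductSpace ℂ E]

/-- `μ` is the spectral measure `μ_ψ = (ψ, E_A(·)ψ)` of the vector `ψ` with respect to the
self-adjoint operator `A`: the (unique) finite Borel measure on the line with
`(ψ, (A - z)⁻¹ψ) = ∫ (λ - z)⁻¹ dμ(λ)` for all non-real `z`.
Here `φ = (A - z)⁻¹ψ` is the unique vector of `D(A)` with `(A - z)φ = ψ`. -/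
def IsSpectralMeasure (A : E →ₗ.[ℂ] E) (ψ : E) (μ : Measure ℝ) : Prop :=
  IsFiniteMeasure μ ∧
    ∀ z : ℂ, z.im ≠ 0 → ∃ φ : A.domain, A φ - z • (φ : E) = ψ ∧
      inner ℂ ψ (φ : E) = ∫ l : ℝ, ((l : ℂ) - z)⁻¹ ∂μ

/-- The subspace of absolute continuity: the vectors whose spectral measure is absolutely continuous
with respect to Lebesgue measure.  (For self-adjoint `A` these vectors already form a closed
subspace; the same applies to the next definition.) -/
def acSubspace (A : E →ₗ.[ℂ] E) : Submodule ℂ E :=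
  (Submodule.span ℂ {ψ | ∃ μ : Measure ℝ, IsSpectralMeasure A ψ μ ∧ μ ≪ volume}).topologicalClosure

/-- The subspace of singular continuity: the vectors whose spectral measure has no atoms and is
singular with respect to Lebesgue measure. -/
def scSubspace (A : E →ₗ.[ℂ] E) : Submodule ℂ E :=
  (Submodule.span ℂ {ψ | ∃ μ : Measure ℝ, IsSpectralMeasure A ψ μ ∧ (∀ x, μ {x} = 0) ∧
    μ ⟂ₘ volume}).topologicalClosure

/-- The subspace of discontinuity: the closed linear hull of all eigenvectors. -/
def ppSubspace (A : E →ₗ.[ℂ] E) : Submodule ℂ E :=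
  (⨆ z : ℂ, eigenspace A z).topologicalClosure

instance [CompleteSpace E] (A : E →ₗ.[ℂ] E) : CompleteSpace (acSubspace A) :=
  inferInstanceAs (CompleteSpace (Submodule.topologicalClosure _))

instance [CompleteSpace E] (A : E →ₗ.[ℂ] E) : CompleteSpace (ppSubspace A) :=
  inferInstanceAs (CompleteSpace (Submodule.topologicalClosure _))

/-- The absolutely continuous part `A_ac`. -/
abbrev acPart (A : E →ₗ.[ℂ] E) : acSubspace A →ₗ.[ℂ] acSubspace A := reducedPart A (acSubspace A)

/-- The singular continuous part `A_sc`. -/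
abbrev scPart (A : E →ₗ.[ℂ] E) : scSubspace A →ₗ.[ℂ] scSubspace A := reducedPart A (scSubspace A)

end Spectral

/-! ### Time operators -/

section Time

variable {E : Type*} [NormedAddCommGroup E] [InnerProductSpace ℂ E]

/-- A symmetric operator: densely defined and contained in its adjoint. -/
def IsSymmetricOp (T : E →ₗ.[ℂ] E) : Prop :=
  Dense (T.domain : Set E) ∧ T.IsFormalAdjoint T

/-- `U t = e^{-itA}`: `U` is the strongly continuous one-parameter unitary group whose
generator is `-iA`. -/
structure IsUnitaryGroup (A : E →ₗ.[ℂ] E) (U : ℝ → E →L[ℂ] E) : Prop where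
  map_zero : U 0 = 1
  map_add : ∀ s t, U (s + t) = U s * U t
  norm_map : ∀ t ψ, ‖U t ψ‖ = ‖ψ‖
  continuous : ∀ ψ, Continuous fun t => U t ψ
  generator : ∀ ψ η : E, (∃ h : ψ ∈ A.domain, A ⟨ψ, h⟩ = η) ↔
    HasDerivAt (fun t => U t ψ) (-(Complex.I • η)) 0

/-- `T` is a strong time operator of the self-adjoint operator `A`: `T` is symmetric,
`e^{-itA} D(T) ⊆ D(T)` and `T e^{-itA} ψ = e^{-itA} (T + t) ψ` for `ψ ∈ D(T)`, `t ∈ ℝ`. -/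
def IsStrongTimeOperator [CompleteSpace E] (A T : E →ₗ.[ℂ] E) : Prop :=
  IsSelfAdjoint A ∧ IsSymmetricOp T ∧ ∃ U : ℝ → E →L[ℂ] E, IsUnitaryGroup A U ∧
    ∀ (t : ℝ) (ψ : T.domain), ∃ h : U t ψ ∈ T.domain,
      T ⟨U t ψ, h⟩ = U t (T ψ + (t : ℂ) • (ψ : E))

/-- `D` is a CCR-domain for the pair `(A, B)`: a non-zero subspace of `D(AB) ∩ D(BA)` on which
`AB - BA = -i`. -/
def IsCCRDomain (A B : E →ₗ.[ℂ] E) (D : Submodule ℂ E) : Prop :=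
  D ≠ ⊥ ∧ ∀ ψ ∈ D, ∃ (hA : ψ ∈ A.domain) (hB : ψ ∈ B.domain)
    (hAB : B ⟨ψ, hB⟩ ∈ A.domain) (hBA : A ⟨ψ, hA⟩ ∈ B.domain),
    A ⟨B ⟨ψ, hB⟩, hAB⟩ - B ⟨A ⟨ψ, hA⟩, hBA⟩ = -(Complex.I • ψ)

/-- Antilinear in the first and linear in the second variable. -/
structure IsSesquilinear {D₁ D₂ : Submodule ℂ E} (t : D₁ → D₂ → ℂ) : Prop where
  add_left : ∀ φ φ' ψ, t (φ + φ') ψ = t φ ψ + t φ' ψ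
  smul_left : ∀ (c : ℂ) φ ψ, t (c • φ) ψ = conj c * t φ ψ
  add_right : ∀ φ ψ ψ', t φ (ψ + ψ') = t φ ψ + t φ ψ'
  smul_right : ∀ (c : ℂ) φ ψ, t φ (c • ψ) = c * t φ ψ

/-- `𝓔` is an ultra-weak CCR-domain for `(H, t)`, with symmetric domain `D`. -/
structure IsUltraWeakCCRDomainWith (H : E →ₗ.[ℂ] E) {D₁ D₂ : Submodule ℂ E} (t : D₁ → D₂ → ℂ)
    (D 𝓔 : Submodule ℂ E) : Prop where
  ne_bot : 𝓔 ≠ ⊥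
  symm_ne_bot : D ≠ ⊥
  symm_le_left : D ≤ D₁
  symm_le_right : D ≤ D₂
  le_symm : 𝓔 ≤ D
  le_domain : 𝓔 ≤ H.domain
  symm : ∀ φ ψ (hφ : φ ∈ D) (hψ : ψ ∈ D),
    conj (t ⟨φ, symm_le_left hφ⟩ ⟨ψ, symm_le_right hψ⟩) =
      t ⟨ψ, symm_le_left hψ⟩ ⟨φ, symm_le_right hφ⟩
  map_mem : ∀ φ (hφ : φ ∈ 𝓔), H ⟨φ, le_domain hφ⟩ ∈ D₁
  ccr : ∀ φ ψ (hφ : φ ∈ 𝓔) (hψ : ψ ∈ 𝓔),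
    t ⟨H ⟨φ, le_domain hφ⟩, map_mem φ hφ⟩ ⟨ψ, symm_le_right (le_symm hψ)⟩ -
      conj (t ⟨H ⟨ψ, le_domain hψ⟩, map_mem ψ hψ⟩ ⟨φ, symm_le_right (le_symm hφ)⟩) =
      -(Complex.I * inner ℂ φ ψ)

/-- `𝓔` is an ultra-weak CCR-domain for `(H, t)`. -/
def IsUltraWeakCCRDomain (H : E →ₗ.[ℂ] E) {D₁ D₂ : Submodule ℂ E} (t : D₁ → D₂ → ℂ)
    (𝓔 : Submodule ℂ E) : Prop :=
  ∃ D : Submodule ℂ E, IsUltraWeakCCRDomainWith H t D 𝓔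

/-- The form `t : D₁ × D₂ → ℂ` is an ultra-weak time operator of `H`. -/
def IsUltraWeakTimeOperator (H : E →ₗ.[ℂ] E) {D₁ D₂ : Submodule ℂ E} (t : D₁ → D₂ → ℂ) : Prop :=
  D₁ ≠ ⊥ ∧ D₂ ≠ ⊥ ∧ IsSesquilinear t ∧ ∃ 𝓔 : Submodule ℂ E, IsUltraWeakCCRDomain H t 𝓔

/-- The class `S₁`. -/
structure ClassS1 [CompleteSpace E] (H : E →ₗ.[ℂ] E) : Prop where
  selfAdjoint : IsSelfAdjoint H
  sc_empty : spectrum (scPart H) = ∅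
  ac_eq : spectrum (acPart H) = (fun x : ℝ => (x : ℂ)) '' Set.Ici 0
  disc_eq : discreteSpectrum H = pointSpectrum H
  point_eq : ∃ e : ℕ → ℝ, pointSpectrum H = Set.range (fun n => (e n : ℂ)) ∧ StrictMono e ∧
    (∀ n, e n < 0) ∧ Filter.Tendsto e Filter.atTop (nhds 0)
  exists_time : ∃ T : acSubspace H →ₗ.[ℂ] acSubspace H, IsStrongTimeOperator (acPart H) T

end Time

/-! ### The form on the point part -/

section PointPart

variable {E : Type*} [NormedAddCommGroup E] [InnerProductSpace ℂ E]

/-- An orthogonal decomposition `𝓗_p(H) = ⊕_{j < N} 𝓗_j` (`N ≤ ∞`), where `𝓗_j` is the closed linear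
hull of the orthonormal eigenvectors `vec j 0, vec j 1, …`, the corresponding eigenvalues
`val j 0, val j 1, …` of `H` being mutually distinct (so that they are simple eigenvalues of the
part of `H` in `𝓗_j`) and square summable. -/
structure EigenDecomposition (H : E →ₗ.[ℂ] E) where
  N : ℕ∞
  vec : {j : ℕ // (j : ℕ∞) < N} → ℕ → E
  val : {j : ℕ // (j : ℕ∞) < N} → ℕ → ℝ
  orthonormal : Orthonormal ℂ (fun p : {j : ℕ // (j : ℕ∞) < N} × ℕ => vec p.1 p.2)
  eigen : ∀ j n, vec j n ∈ eigenspace H (val j n)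
  injective : ∀ j, Function.Injective (val j)
  summable : ∀ j, Summable fun n => val j n ^ 2
  span_eq : (Submodule.span ℂ (Set.range
    (fun p : {j : ℕ // (j : ℕ∞) < N} × ℕ => vec p.1 p.2))).topologicalClosure = ppSubspace H

namespace EigenDecomposition

variable {H : E →ₗ.[ℂ] E} (d : EigenDecomposition H)

/-- The index set `{j | j < N}`. -/
abbrev Idx : Type := {j : ℕ // (j : ℕ∞) < d.N}

/-- The domain `D(S_j)`, the linear hull of the `e_n^j`, `n ∈ ℕ`. -/
def domS (j : d.Idx) : Submodule ℂ E := Submodule.span ℂ (Set.range (d.vec j))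

/-- The closed subspace `𝓗_j`. -/
def space (j : d.Idx) : Submodule ℂ E := (d.domS j).topologicalClosure

instance [CompleteSpace E] (j : d.Idx) : CompleteSpace (d.space j) :=
  inferInstanceAs (CompleteSpace (Submodule.topologicalClosure _))

/-- The operator `S_j`, with domain `D(S_j)`:
`S_j φ = i ∑_n (∑_{m ≠ n} (e_m, φ) / (1 / F_n - 1 / F_m)) e_n`.
For `φ` in `D(S_j)` the inner sum is finite and the outer one converges in norm. -/
def opS (j : d.Idx) (φ : E) : E :=
  Complex.I • ∑' n, (∑' m, if m = n then 0 else
    inner ℂ (d.vec j m) φ / (1 / (d.val j n : ℂ) - 1 / (d.val j m : ℂ))) • d.vec j n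

/-- `H⁻² ψ` (`0` outside the domain of `H⁻²`).  For injective `H` the inverse of the part of `H`
in `𝓗_j` is the restriction of `H⁻¹`, so that on `D(S_j)` this is `H_j⁻² ψ`. -/
def invSq (H : E →ₗ.[ℂ] E) (ψ : E) : E := value H.inverse (value H.inverse ψ)

/-- `t_j[φ, ψ] = -((S_j φ, H_j⁻² ψ) + (H_j⁻² φ, S_j ψ)) / 2` for `φ, ψ ∈ D(S_j)`. -/
def formJ (j : d.Idx) (φ ψ : E) : ℂ :=
  -(1 / 2) * (inner ℂ (d.opS j φ) (invSq H ψ) + inner ℂ (invSq H φ) (d.opS j ψ))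

/-- The domain `D_p = ⊕_j D(S_j)` (algebraic direct sum). -/
def domP : Submodule ℂ E := ⨆ j, d.domS j

/-- `t_p[φ, ψ] = ∑_j t_j[φ_j, ψ_j]` for `φ, ψ ∈ D_p`, with `φ_j` the component of `φ` in `𝓗_j`; only
finitely many components are non-zero. -/
def formP [CompleteSpace E] (φ ψ : E) : ℂ :=
  ∑ᶠ j, d.formJ j ((d.space j).starProjection φ) ((d.space j).starProjection ψ)

/-- `𝓔_p = ⊕_j 𝓔_j` (algebraic direct sum) with `𝓔_j` the linear hull of all `e_n^j - e_m^j`. -/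
def ccrP : Submodule ℂ E :=
  ⨆ j, Submodule.span ℂ {x | ∃ n m, x = d.vec j n - d.vec j m}

/-- `H_p⁻¹ 𝓔_p`, the set of all `φ ∈ D(H)` in `𝓗_p(H)` with `H φ ∈ 𝓔_p`. -/
def invCcrP : Submodule ℂ E :=
  (d.ccrP.comap H.toFun).map H.domain.subtype ⊓ ppSubspace H

/-- `H_p 𝓔_p`, the image of `𝓔_p` under `H`. -/
def mapCcrP : Submodule ℂ E := (d.ccrP.comap H.domain.subtype).map H.toFun

end EigenDecomposition

/-! ### The form `t_H` -/

variable {H : E →ₗ.[ℂ] E}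

/-- The direct sum `A ⊕ B` of a subspace `A` of `𝓗_ac(H)` and a subspace `B` of `𝓗_p(H)`. -/
def dirSum (A : Submodule ℂ (acSubspace H)) (B : Submodule ℂ E) : Submodule ℂ E :=
  A.map (acSubspace H).subtype ⊔ B

/-- The form `t_H` on `(𝓗_ac(H) ⊕ D_p) × (D(T) ⊕ D_p)`,
`t_H[φ₁ ⊕ φ₂, ψ₁ ⊕ ψ₂] = (φ₁, T ψ₁) + t_p[φ₂, ψ₂]`, the components being obtained by orthogonal
projection. -/
def formH [CompleteSpace E] (T : acSubspace H →ₗ.[ℂ] acSubspace H) (d : EigenDecomposition H)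
    (φ : dirSum (⊤ : Submodule ℂ (acSubspace H)) d.domP) (ψ : dirSum T.domain d.domP) : ℂ :=
  inner ℂ ((acSubspace H).orthogonalProjectionOnto (φ : E))
      (value T ((acSubspace H).orthogonalProjectionOnto (ψ : E))) +
    d.formP ((ppSubspace H).starProjection (φ : E)) ((ppSubspace H).starProjection (ψ : E))

end PointPart

end TimeOperator

end

/-!
By the spectral theorem, `H = H_ac ⊕ H_sc ⊕ H_p`, and `H_sc` acts on the zero space because its
spectrum is empty.

On the absolutely continuous part, put `ψ_f = ∫ f(t) e^{itH_ac} ψ dt` for a test function `f` and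
`ψ ∈ D(T)`.  Then `H_ac ψ_f = i ψ_{f'}` and, as `T` is closed, `T ψ_f = (T ψ)_f - ψ_{tf}`; since
`(tf)' - t f' = f`, the commutator `H_ac T - T H_ac` maps `ψ_f` to `-i ψ_f`, and approximate
identities show that the span of the `ψ_f` is dense.

On the point part, write `p = (j, n)`.  In the basis `e_p` the form `t_p` has a matrix `t_{pq}` with
`(F_p - F_q) t_{pq} + i δ_{pq} = (i / 2) (F_p / F_q + F_q / F_p)` whenever `p` and `q` have the same
`j`.  On `H_p 𝓔_p` and `H_p⁻¹ 𝓔_p` this is multiplied by `w_p w_q` with `w = F` and `w = 1 / F`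
respectively, which turns the right-hand side into a sum `u_p + u_q`; such a matrix annihilates
coefficient vectors whose sum over each `j` vanishes.  On `𝓔_p` itself, where `w = 1`, this fails.
Density of `H_p 𝓔_p` comes from `F_{jn} e_n^j - F_{jm} e_m^j → F_{jn} e_n^j` as `m → ∞`.
-/

noncomputable section

namespace TimeOperator

section Graph

variable {E : Type*} [NormedAddCommGroup E] [InnerProductSpace ℂ E]

theorem value_of_mem {A : E →ₗ.[ℂ] E} {x : E} (h : x ∈ A.domain) : value A x = A ⟨x, h⟩ :=
  dif_pos h

theorem mem_graph_iff_exists_apply_eq {A : E →ₗ.[ℂ] E} {x y : E} :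
    (x, y) ∈ A.graph ↔ ∃ h : x ∈ A.domain, A ⟨x, h⟩ = y := by
  simp [LinearPMap.mem_graph_iff]

theorem value_eq_of_mem_graph {A : E →ₗ.[ℂ] E} {x y : E} (h : (x, y) ∈ A.graph) :
    value A x = y := by
  obtain ⟨hx, rfl⟩ := mem_graph_iff_exists_apply_eq.mp h
  exact value_of_mem hx

theorem mem_eigenspace_iff {A : E →ₗ.[ℂ] E} {z : ℂ} {x : E} :
    x ∈ eigenspace A z ↔ (x, z • x) ∈ A.graph := by
  simp [eigenspace, sub_eq_zero]

theorem mem_graph_reducedPart_iff {A : E →ₗ.[ℂ] E} {K : Submodule ℂ E} {x y : K} :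
    (x, y) ∈ (reducedPart A K).graph ↔ ((x : E), (y : E)) ∈ A.graph := by
  rw [mem_graph_iff_exists_apply_eq, mem_graph_iff_exists_apply_eq]
  constructor
  · rintro ⟨h, rfl⟩
    exact ⟨h.choose, rfl⟩
  · rintro ⟨h, hy⟩
    exact ⟨⟨h, hy ▸ y.2⟩, Subtype.ext hy⟩

theorem isFormalAdjoint_iff_forall_mem_graph {A : E →ₗ.[ℂ] E} :
    A.IsFormalAdjoint A ↔ ∀ {x y x' y' : E}, (x, y) ∈ A.graph → (x', y') ∈ A.graph →
      inner ℂ y x' = inner ℂ x y' := by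
  simp only [LinearPMap.IsFormalAdjoint, mem_graph_iff_exists_apply_eq]
  constructor
  · rintro h x _ x' _ ⟨hx, rfl⟩ ⟨hx', rfl⟩
    exact h ⟨x, hx⟩ ⟨x', hx'⟩
  · rintro h ⟨x, hx⟩ ⟨x', hx'⟩
    exact h ⟨hx, rfl⟩ ⟨hx', rfl⟩

theorem reducedPart_isFormalAdjoint {A : E →ₗ.[ℂ] E} (hA : A.IsFormalAdjoint A)
    (K : Submodule ℂ E) : (reducedPart A K).IsFormalAdjoint (reducedPart A K) := by
  rw [isFormalAdjoint_iff_forall_mem_graph] at hA ⊢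
  exact fun hx hy => hA (mem_graph_reducedPart_iff.mp hx) (mem_graph_reducedPart_iff.mp hy)

theorem im_inner_sub_smul {A : E →ₗ.[ℂ] E} (hA : A.IsFormalAdjoint A) {z : ℂ}
    {x y : E} (h : (x, y) ∈ A.graph) :
    (inner ℂ x (y - z • x)).im = -(z.im * ‖x‖ ^ 2) := by
  have hreal : conj (inner ℂ x y) = inner ℂ x y := by
    rw [inner_conj_symm, isFormalAdjoint_iff_forall_mem_graph.mp hA h h]
  rw [inner_sub_right, inner_smul_right, inner_self_eq_norm_sq_to_K, Complex.sub_im,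
    Complex.conj_eq_iff_im.mp hreal]
  simp [← Complex.ofReal_pow]

theorem abs_im_mul_norm_le {A : E →ₗ.[ℂ] E} (hA : A.IsFormalAdjoint A) (z : ℂ) {x y : E}
    (h : (x, y) ∈ A.graph) : |z.im| * ‖x‖ ≤ ‖y - z • x‖ := by
  rcases (norm_nonneg x).eq_or_lt with hx | hx
  · simp [← hx]
  refine le_of_mul_le_mul_left ?_ hx
  calc ‖x‖ * (|z.im| * ‖x‖) = |(inner ℂ x (y - z • x)).im| := by
        rw [im_inner_sub_smul hA h, abs_neg, abs_mul, abs_of_nonneg (sq_nonneg ‖x‖)]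
        ring
    _ ≤ ‖x‖ * ‖y - z • x‖ := (Complex.abs_im_le_norm _).trans (norm_inner_le_norm _ _)

variable [CompleteSpace E]

theorem isFormalAdjoint_of_isSelfAdjoint {A : E →ₗ.[ℂ] E} (hA : IsSelfAdjoint A) :
    A.IsFormalAdjoint A := by
  simpa only [LinearPMap.isSelfAdjoint_def.mp hA] using
    LinearPMap.adjoint_isFormalAdjoint hA.dense_domain

theorem mem_graph_of_forall_inner_eq {A : E →ₗ.[ℂ] E} (hA : IsSelfAdjoint A) {y w : E}
    (h : ∀ x : A.domain, inner ℂ w (x : E) = inner ℂ y (A x)) : (y, w) ∈ A.graph := by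
  have hy : y ∈ A.adjoint.domain := LinearPMap.mem_adjoint_domain_of_exists _ ⟨w, h⟩
  rw [← LinearPMap.isSelfAdjoint_def.mp hA, mem_graph_iff_exists_apply_eq]
  exact ⟨hy, LinearPMap.adjoint_apply_eq hA.dense_domain ⟨y, hy⟩ h⟩

end Graph

section Resolvent

variable {E : Type*} [NormedAddCommGroup E] [InnerProductSpace ℂ E]

/-- `R` is the resolvent `(A - z)⁻¹`.  Stating this through the graph of `A` avoids carrying
proofs of membership in the domain of `A`. -/
structure IsResolventAt (A : E →ₗ.[ℂ] E) (z : ℂ) (R : E →L[ℂ] E) : Prop where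
  mem_graph : ∀ x, (R x, x + z • R x) ∈ A.graph
  apply_sub : ∀ {x y : E}, (x, y) ∈ A.graph → R (y - z • x) = x

theorem mem_resolventSet_iff {A : E →ₗ.[ℂ] E} {z : ℂ} :
    z ∈ resolventSet A ↔ ∃ R, IsResolventAt A z R := by
  refine exists_congr fun R => ?_
  constructor
  · rintro ⟨h₁, h₂⟩
    refine ⟨fun x => ?_, fun {x y} h => ?_⟩
    · obtain ⟨h, hx⟩ := h₁ x
      exact mem_graph_iff_exists_apply_eq.mpr ⟨h, sub_eq_iff_eq_add.mp hx⟩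
    · obtain ⟨hx, rfl⟩ := mem_graph_iff_exists_apply_eq.mp h
      exact h₂ ⟨x, hx⟩
  · rintro ⟨h₁, h₂⟩
    refine ⟨fun x => ?_, fun x => h₂ (LinearPMap.mem_graph A x)⟩
    obtain ⟨h, hx⟩ := mem_graph_iff_exists_apply_eq.mp (h₁ x)
    exact ⟨h, sub_eq_iff_eq_add.mpr hx⟩

namespace IsResolventAt

variable {A : E →ₗ.[ℂ] E} {z w : ℂ} {R S : E →L[ℂ] E}

theorem apply_eq_zero_iff (hR : IsResolventAt A z R) {x : E} : R x = 0 ↔ x = 0 := by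
  refine ⟨fun hx => ?_, fun hx => by rw [hx, map_zero]⟩
  have h := hR.mem_graph x
  simp only [hx, smul_zero, add_zero] at h
  exact A.graph_fst_eq_zero_snd h rfl

theorem sub_eq (hR : IsResolventAt A z R) (hS : IsResolventAt A w S) :
    R - S = (z - w) • (R * S) := by
  ext x
  have h := hR.apply_sub (hS.mem_graph x)
  simp only [map_sub, map_add, map_smul] at h
  change R x - S x = (z - w) • R (S x)
  linear_combination (norm := module) h

theorem isUnit_one_sub_smul (hR : IsResolventAt A z R) (hS : IsResolventAt A w S) :
    IsUnit (1 - (w - z) • R) := by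
  refine isUnit_iff_exists.mpr ⟨1 - (z - w) • S, ?_, ?_⟩
  · have h := hR.sub_eq hS
    linear_combination (norm := skip) (z - w) • h
    simp only [mul_sub, sub_mul, smul_mul_assoc, mul_smul_comm, mul_one, one_mul, smul_sub]
    module
  · have h := hS.sub_eq hR
    linear_combination (norm := skip) (w - z) • h
    simp only [mul_sub, sub_mul, smul_mul_assoc, mul_smul_comm, mul_one, one_mul, smul_sub]
    module

theorem inner_left (hA : A.IsFormalAdjoint A) (hR : IsResolventAt A z R)
    (hS : IsResolventAt A (conj z) S) (x y : E) : inner ℂ (S x) y = inner ℂ x (R y) := by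
  have h := isFormalAdjoint_iff_forall_mem_graph.mp hA (hS.mem_graph x) (hR.mem_graph y)
  simp only [inner_add_left, inner_add_right, inner_smul_left, inner_smul_right,
    Complex.conj_conj] at h
  exact (add_right_cancel h).symm

end IsResolventAt

theorem subsingleton_of_spectrum_eq_empty [CompleteSpace E] {A : E →ₗ.[ℂ] E}
    (hA : A.IsFormalAdjoint A) (h : spectrum A = ∅) : Subsingleton E := by
  have hres : ∀ z, ∃ R, IsResolventAt A z R := fun z =>
    mem_resolventSet_iff.mp (Set.compl_empty_iff.mp h ▸ Set.mem_univ z)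
  obtain ⟨R, hR⟩ := hres 0
  have hsa : IsSelfAdjoint R := by
    rw [ContinuousLinearMap.isSelfAdjoint_iff_isSymmetric]
    exact hR.inner_left hA (by rwa [map_zero])
  have hspec : _root_.spectrum ℂ R ⊆ {0} := by
    intro l hl
    by_contra hl0
    rw [Set.mem_singleton_iff] at hl0
    obtain ⟨S, hS⟩ := hres l⁻¹
    have hunit := (isUnit_smul_iff (Units.mk0 l hl0) _).mpr (hR.isUnit_one_sub_smul hS)
    rw [Units.smul_def, Units.val_mk0, sub_zero, smul_sub, smul_inv_smul₀ hl0,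
      ← Algebra.algebraMap_eq_smul_one] at hunit
    exact hl hunit
  have hR0 : R = 0 := CFC.eq_zero_of_spectrum_subset_zero (R := ℂ) R hspec hsa.isStarNormal
  exact subsingleton_of_forall_eq 0 fun x => hR.apply_eq_zero_iff.mp (by rw [hR0]; rfl)

theorem nontrivial_of_spectrum_nonempty {A : E →ₗ.[ℂ] E} (h : (spectrum A).Nonempty) :
    Nontrivial E := by
  by_contra hE
  rw [not_nontrivial_iff_subsingleton] at hE
  obtain ⟨z, hz⟩ := h
  exact hz (mem_resolventSet_iff.mpr ⟨0,
    fun x => by rw [Subsingleton.elim ((0 : E →L[ℂ] E) x, x + z • (0 : E →L[ℂ] E) x) 0]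
                exact A.graph.zero_mem,
    fun _ => Subsingleton.elim _ _⟩)

theorem scSubspace_eq_bot [CompleteSpace E] {A : E →ₗ.[ℂ] E} (hA : A.IsFormalAdjoint A)
    (h : spectrum (scPart A) = ∅) : scSubspace A = ⊥ := by
  have : CompleteSpace (scSubspace A) :=
    inferInstanceAs (CompleteSpace (Submodule.topologicalClosure _))
  exact Submodule.subsingleton_iff_eq_bot.mp
    (subsingleton_of_spectrum_eq_empty (reducedPart_isFormalAdjoint hA _) h)

/-- The map `(x, A x) ↦ A x - z x` on the graph of `A`.  When `A` is closed its domain is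
complete, which makes the open mapping theorem applicable to the unbounded operator `A - z`. -/
def graphSub (A : E →ₗ.[ℂ] E) (z : ℂ) : A.graph →L[ℂ] E :=
  (ContinuousLinearMap.snd ℂ E E - z • ContinuousLinearMap.fst ℂ E E).comp A.graph.subtypeL

theorem graphSub_apply (A : E →ₗ.[ℂ] E) (z : ℂ) (p : A.graph) :
    graphSub A z p = (p : E × E).2 - z • (p : E × E).1 := rfl

theorem exists_antilipschitzWith_graphSub {A : E →ₗ.[ℂ] E} (hA : A.IsFormalAdjoint A) {z : ℂ}
    (hz : z.im ≠ 0) : ∃ C, AntilipschitzWith C (graphSub A z) := by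
  have hz' : 0 < |z.im| := abs_pos.mpr hz
  refine ⟨⟨(1 + ‖z‖) / |z.im| + 1, by positivity⟩,
    (graphSub A z).antilipschitz_of_bound fun p => ?_⟩
  have hfst : ‖(p : E × E).1‖ ≤ ‖graphSub A z p‖ / |z.im| := by
    rw [le_div_iff₀' hz']
    exact abs_im_mul_norm_le hA z p.2
  have hsnd : ‖(p : E × E).2‖ ≤ ‖graphSub A z p‖ + ‖z‖ * ‖(p : E × E).1‖ := by
    rw [← norm_smul]
    exact norm_le_norm_sub_add _ _
  calc ‖p‖ ≤ ‖(p : E × E).1‖ + ‖(p : E × E).2‖ :=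
        max_le_add_of_nonneg (norm_nonneg _) (norm_nonneg _)
    _ ≤ (1 + ‖z‖) * ‖(p : E × E).1‖ + ‖graphSub A z p‖ := by linarith
    _ ≤ (1 + ‖z‖) * (‖graphSub A z p‖ / |z.im|) + ‖graphSub A z p‖ := by gcongr
    _ = ((1 + ‖z‖) / |z.im| + 1) * ‖graphSub A z p‖ := by ring

theorem orthogonal_range_graphSub [CompleteSpace E] {A : E →ₗ.[ℂ] E} (hA : IsSelfAdjoint A)
    {z : ℂ} (hz : z.im ≠ 0) : (graphSub A z).rangeᗮ = ⊥ := by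
  rw [Submodule.eq_bot_iff]
  intro y hy
  have hker : (y, conj z • y) ∈ A.graph := by
    refine mem_graph_of_forall_inner_eq hA fun x => ?_
    have h : inner ℂ y (A x - z • (x : E)) = 0 :=
      Submodule.inner_left_of_mem_orthogonal (K := (graphSub A z).range)
        ⟨⟨_, A.mem_graph x⟩, rfl⟩ hy
    rw [inner_sub_right, inner_smul_right, sub_eq_zero] at h
    rw [inner_smul_left, Complex.conj_conj, h]
  have h := abs_im_mul_norm_le (isFormalAdjoint_of_isSelfAdjoint hA) (conj z) hker
  rw [sub_self, norm_zero, Complex.conj_im, abs_neg] at h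
  exact norm_le_zero_iff.mp (nonpos_of_mul_nonpos_right h (abs_pos.mpr hz))

theorem exists_isResolventAt_of_im_ne_zero [CompleteSpace E] {A : E →ₗ.[ℂ] E}
    (hA : IsSelfAdjoint A) {z : ℂ} (hz : z.im ≠ 0) : ∃ R, IsResolventAt A z R := by
  obtain ⟨C, hC⟩ := exists_antilipschitzWith_graphSub (isFormalAdjoint_of_isSelfAdjoint hA) hz
  have : CompleteSpace A.graph := hA.isClosed.completeSpace_coe
  have hrange : (graphSub A z).range = ⊤ := by
    have hcl : IsClosed ((graphSub A z).range : Set E) :=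
      hC.isClosed_range (graphSub A z).uniformContinuous
    rw [← hcl.submodule_topologicalClosure_eq, Submodule.topologicalClosure_eq_top_iff,
      orthogonal_range_graphSub hA hz]
  let e := ContinuousLinearEquiv.ofBijective (graphSub A z)
    (LinearMap.ker_eq_bot.mpr hC.injective) hrange
  refine ⟨(ContinuousLinearMap.fst ℂ E E).comp
      (A.graph.subtypeL.comp (e.symm : E →L[ℂ] A.graph)), fun x => ?_,
    fun {x y} h => ?_⟩
  · have h : graphSub A z (e.symm x) = x := e.apply_symm_apply x
    rw [graphSub_apply, sub_eq_iff_eq_add] at h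
    convert (e.symm x).2 using 1
    exact Prod.ext rfl h.symm
  · exact congrArg (fun p : A.graph => (p : E × E).1) (e.symm_apply_apply ⟨(x, y), h⟩)

end Resolvent

section Eigenvectors

variable {E : Type*} [NormedAddCommGroup E] [InnerProductSpace ℂ E] {A : E →ₗ.[ℂ] E}

theorem conj_eq_of_mem_eigenspace (hA : A.IsFormalAdjoint A) {z : ℂ} {x : E}
    (hx : x ∈ eigenspace A z) (hx0 : x ≠ 0) : conj z = z := by
  rw [mem_eigenspace_iff] at hx
  have h := isFormalAdjoint_iff_forall_mem_graph.mp hA hx hx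
  rw [inner_smul_left, inner_smul_right] at h
  exact mul_right_cancel₀ (inner_self_ne_zero.mpr hx0) h

theorem eigenspace_isOrtho_eigenspace (hA : A.IsFormalAdjoint A) {z w : ℂ} (hzw : z ≠ w) :
    eigenspace A z ⟂ eigenspace A w := by
  refine Submodule.isOrtho_iff_inner_eq.mpr fun x hx y hy => ?_
  rcases eq_or_ne x 0 with rfl | hx0
  · exact inner_zero_left _
  have h := isFormalAdjoint_iff_forall_mem_graph.mp hA (mem_eigenspace_iff.mp hx)
    (mem_eigenspace_iff.mp hy)
  rw [inner_smul_left, inner_smul_right, conj_eq_of_mem_eigenspace hA hx hx0] at h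
  by_contra h0
  exact hzw (mul_right_cancel₀ h0 h)

open Filter Topology

theorem norm_mul_inv_ofReal_sub_le_one {ε : ℝ} (hε : 0 < ε) (l a : ℝ) :
    ‖(ε : ℂ) * ((l : ℂ) - (a + ε * Complex.I))⁻¹‖ ≤ 1 := by
  have him : ε ≤ ‖(l : ℂ) - (a + ε * Complex.I)‖ := by
    simpa [abs_of_pos hε] using Complex.abs_im_le_norm ((l : ℂ) - (a + ε * Complex.I))
  rw [norm_mul, norm_inv, Complex.norm_of_nonneg hε.le]
  exact mul_inv_le_one_of_le₀ him (norm_nonneg _)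

theorem tendsto_mul_integral_inv_sub_of_measure_singleton_eq_zero {μ : Measure ℝ}
    [IsFiniteMeasure μ] {a : ℝ} (ha : μ {a} = 0) :
    Tendsto (fun ε : ℝ => (ε : ℂ) * ∫ l : ℝ, ((l : ℂ) - (a + ε * Complex.I))⁻¹ ∂μ)
      (𝓝[>] 0) (𝓝 0) := by
  simp_rw [← integral_const_mul]
  rw [← integral_zero ℝ ℂ (μ := μ)]
  refine tendsto_integral_filter_of_dominated_convergence (fun _ => 1)
    (Eventually.of_forall fun ε => Measurable.aestronglyMeasurable (by fun_prop)) ?_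
    (integrable_const _) ?_
  · filter_upwards [self_mem_nhdsWithin] with ε hε
    exact Eventually.of_forall fun l => norm_mul_inv_ofReal_sub_le_one hε l a
  · filter_upwards [measure_eq_zero_iff_ae_notMem.mp ha] with l hl
    have hla : (l : ℂ) - (a + ((0 : ℝ) : ℂ) * Complex.I) ≠ 0 := by
      simpa [sub_eq_zero] using hl
    have hcont : ContinuousAt
        (fun ε : ℝ => (ε : ℂ) * ((l : ℂ) - (a + ε * Complex.I))⁻¹) 0 := by
      fun_prop (disch := exact hla)
    simpa using hcont.tendsto.mono_left nhdsWithin_le_nhds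

theorem inner_eq_zero_of_mem_eigenspace_of_isSpectralMeasure (hA : A.IsFormalAdjoint A) {a : ℝ}
    {x ψ : E} (hx : x ∈ eigenspace A a) {μ : Measure ℝ} (hμ : IsSpectralMeasure A ψ μ)
    (ha : μ {a} = 0) : inner ℂ x ψ = 0 := by
  obtain ⟨_, hμ⟩ := hμ
  -- With `φ = (A - (a + iε))⁻¹ψ` one has `(x, ψ) = -iε (x, φ)`, and `ε ‖φ‖² = Im (ψ, φ)`.
  have hbound : ∀ ε : ℝ, 0 < ε → ‖inner ℂ x ψ‖ ^ 2 ≤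
      ‖x‖ ^ 2 * ‖(ε : ℂ) * ∫ l : ℝ, ((l : ℂ) - (a + ε * Complex.I))⁻¹ ∂μ‖ := by
    intro ε hε
    have him : ((a : ℂ) + ε * Complex.I).im = ε := by simp
    obtain ⟨φ, hφ, hint⟩ := hμ (a + ε * Complex.I) (by rw [him]; exact hε.ne')
    have hinner : inner ℂ x ψ = -(ε * Complex.I) * inner ℂ x (φ : E) := by
      rw [← hφ, inner_sub_right, inner_smul_right,
        ← isFormalAdjoint_iff_forall_mem_graph.mp hA (mem_eigenspace_iff.mp hx) (A.mem_graph φ),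
        inner_smul_left, Complex.conj_ofReal]
      ring
    have hnorm : ε * ‖(φ : E)‖ ^ 2 ≤ ‖inner ℂ ψ (φ : E)‖ := by
      have h := im_inner_sub_smul hA (z := a + ε * Complex.I) (A.mem_graph φ)
      rw [hφ, him] at h
      rw [norm_inner_symm, ← abs_of_nonneg (by positivity : 0 ≤ ε * ‖(φ : E)‖ ^ 2), ← abs_neg, ← h]
      exact Complex.abs_im_le_norm _
    calc ‖inner ℂ x ψ‖ ^ 2 = ε ^ 2 * ‖inner ℂ x (φ : E)‖ ^ 2 := by
          rw [hinner, norm_mul, mul_pow]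
          simp [abs_of_pos hε]
      _ ≤ ε ^ 2 * (‖x‖ * ‖(φ : E)‖) ^ 2 := by gcongr; exact norm_inner_le_norm _ _
      _ = ‖x‖ ^ 2 * (ε * (ε * ‖(φ : E)‖ ^ 2)) := by ring
      _ ≤ ‖x‖ ^ 2 * (ε * ‖inner ℂ ψ (φ : E)‖) := by gcongr
      _ = _ := by rw [hint, norm_mul, Complex.norm_of_nonneg hε.le]
  have hlim := (tendsto_mul_integral_inv_sub_of_measure_singleton_eq_zero ha).norm.const_mul
    (‖x‖ ^ 2)
  rw [norm_zero, mul_zero] at hlim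
  have h := ge_of_tendsto hlim (eventually_nhdsWithin_of_forall hbound)
  exact norm_eq_zero.mp (pow_eq_zero_iff two_ne_zero |>.mp (h.antisymm (sq_nonneg _)))

theorem acSubspace_isOrtho_ppSubspace (hA : A.IsFormalAdjoint A) :
    acSubspace A ⟂ ppSubspace A := by
  rw [acSubspace, ppSubspace, Submodule.isOrtho_iff_le, Submodule.orthogonal_closure]
  refine Submodule.topologicalClosure_minimal _ ?_ (Submodule.isClosed_orthogonal _)
  rw [← Submodule.isOrtho_iff_le, Submodule.isOrtho_iSup_right]
  intro z
  rw [Submodule.isOrtho_iff_le, Submodule.span_le]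
  rintro ψ ⟨μ, hμ, hac⟩ x hx
  rcases eq_or_ne x 0 with rfl | hx0
  · exact inner_zero_left _
  rw [← Complex.conj_eq_iff_re.mp (conj_eq_of_mem_eigenspace hA hx hx0)] at hx
  exact inner_eq_zero_of_mem_eigenspace_of_isSpectralMeasure hA hx hμ (hac (by simp))

end Eigenvectors

section FunctionalCalculus

variable {E : Type*} [NormedAddCommGroup E] [InnerProductSpace ℂ E] {α : Type*}
  [MeasurableSpace α] {μ : Measure α} {P : Set α → E}

/-- `P` is an orthogonally scattered vector measure with control measure `μ`, such as
`B ↦ E(B)ψ` for a projection-valued measure `E` and a vector `ψ`.  Countable additivity is a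
consequence of this condition.  The values of `P` on non-measurable sets are irrelevant. -/
def IsOrthogonallyScattered (μ : Measure α) (P : Set α → E) : Prop :=
  ∀ ⦃B C : Set α⦄, MeasurableSet B → MeasurableSet C →
    inner ℂ (P B) (P C) = (μ.real (B ∩ C) : ℂ)

namespace IsOrthogonallyScattered

theorem norm_sub_sum_sq {ι : Type*} (hP : IsOrthogonallyScattered μ P) {f : ι → Set α}
    (hf : ∀ i, MeasurableSet (f i)) (hd : Pairwise (Function.onFun Disjoint f)) {B : Set α}
    (hB : MeasurableSet B) (hfB : ∀ i, f i ⊆ B) (s : Finset ι) :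
    ‖P B - ∑ i ∈ s, P (f i)‖ ^ 2 = μ.real B - ∑ i ∈ s, μ.real (f i) := by
  classical
  have hsum : ∀ i ∈ s, ∑ j ∈ s, inner ℂ (P (f i)) (P (f j)) = (μ.real (f i) : ℂ) := by
    intro i hi
    rw [Finset.sum_eq_single_of_mem i hi fun j _ hj => ?_, hP (hf i) (hf i), Set.inter_self]
    rw [hP (hf i) (hf j), (hd hj.symm).inter_eq, measureReal_empty, Complex.ofReal_zero]
  apply Complex.ofReal_injective
  rw [Complex.ofReal_pow, ← Complex.coe_algebraMap, ← inner_self_eq_norm_sq_to_K (𝕜 := ℂ),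
    inner_sub_sub_self]
  simp only [sum_inner, inner_sum, hP hB hB, hP hB (hf _), hP (hf _) hB, Set.inter_self,
    Set.inter_eq_self_of_subset_left (hfB _), Set.inter_eq_self_of_subset_right (hfB _)]
  rw [Finset.sum_comm, Finset.sum_congr rfl hsum]
  simp

theorem hasSum_iUnion [IsFiniteMeasure μ] {ι : Type*} [Countable ι]
    (hP : IsOrthogonallyScattered μ P) {f : ι → Set α} (hf : ∀ i, MeasurableSet (f i))
    (hd : Pairwise (Function.onFun Disjoint f)) :
    HasSum (fun i => P (f i)) (P (⋃ i, f i)) := by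
  have hμ : μ (⋃ i, f i) = ∑' i, μ (f i) := measure_iUnion hd hf
  have hsum : HasSum (fun i => μ.real (f i)) (μ.real (⋃ i, f i)) := by
    have hfin : ∑' i, μ (f i) ≠ ⊤ := hμ ▸ measure_ne_top μ _
    have h := ENNReal.hasSum_toReal hfin
    rwa [← ENNReal.tsum_toReal_eq fun i => measure_ne_top μ (f i), ← hμ] at h
  have hlim := (hsum.const_sub (μ.real (⋃ i, f i))).sqrt
  simp only [← hP.norm_sub_sum_sq hf hd (.iUnion hf) (Set.subset_iUnion f), sub_self,
    Real.sqrt_sq (norm_nonneg _), Real.sqrt_zero] at hlim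
  exact tendsto_iff_norm_sub_tendsto_zero.mpr (by simpa only [norm_sub_rev] using hlim)

theorem union [IsFiniteMeasure μ] (hP : IsOrthogonallyScattered μ P) {B C : Set α}
    (hB : MeasurableSet B) (hC : MeasurableSet C) (hd : Disjoint B C) :
    P (B ∪ C) = P B + P C := by
  have h := hP.hasSum_iUnion (f := fun b : Bool => cond b B C) (Bool.forall_bool.mpr ⟨hC, hB⟩)
    (pairwise_disjoint_on_bool.mpr hd)
  rw [← Set.union_eq_iUnion] at h
  simpa using h.unique (hasSum_fintype _)

theorem mem_of_countable [IsFiniteMeasure μ] [MeasurableSingletonClass α]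
    (hP : IsOrthogonallyScattered μ P) {K : Submodule ℂ E} (hK : IsClosed (K : Set E)) {S : Set α}
    (hS : S.Countable) (hPK : ∀ a ∈ S, P {a} ∈ K) : P S ∈ K := by
  have : Countable S := hS
  have h := hP.hasSum_iUnion (f := fun a : S => {(a : α)}) (fun a => measurableSet_singleton _)
    fun a b hab => by simpa [Function.onFun] using fun h => hab (Subtype.ext h)
  rw [Set.iUnion_of_singleton_coe] at h
  exact hK.mem_of_tendsto h (Filter.Eventually.of_forall fun s =>
    K.sum_mem fun a _ => hPK a a.2)

end IsOrthogonallyScattered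

variable {X : Type*} [TopologicalSpace X]

theorem inner_starAlgHom_left [CompleteSpace E] (Φ : C(X, ℂ) →⋆ₐ[ℂ] (E →L[ℂ] E)) (f : C(X, ℂ))
    (x y : E) : inner ℂ (Φ f x) y = inner ℂ x (Φ (star f) y) := by
  rw [map_star, ContinuousLinearMap.star_eq_adjoint, ContinuousLinearMap.adjoint_inner_right]

theorem inner_starAlgHom_star_mul_self [CompleteSpace E] (Φ : C(X, ℂ) →⋆ₐ[ℂ] (E →L[ℂ] E)) (ψ : E)
    (f : C(X, ℂ)) : inner ℂ ψ (Φ (star f * f) ψ) = (‖Φ f ψ‖ : ℂ) ^ 2 := by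
  rw [map_mul, mul_apply_eq_comp, ← inner_starAlgHom_left, inner_self_eq_norm_sq_to_K]
  rfl

/-- `P B = E(B)ψ`, where `E` is the projection-valued measure of the representation `Φ`, and `ν` is
the spectral measure of `ψ`. -/
structure IsSpectralFamily [CompleteSpace E] [MeasurableSpace X]
    (Φ : C(X, ℂ) →⋆ₐ[ℂ] (E →L[ℂ] E)) (ψ : E) (ν : Measure X) (P : Set X → E) : Prop where
  univ : P Set.univ = ψ
  inner_apply : ∀ ⦃B C : Set X⦄, MeasurableSet B → MeasurableSet C → ∀ f : C(X, ℂ),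
    inner ℂ (P B) (Φ f (P C)) = ∫ x in B ∩ C, f x ∂ν

namespace IsSpectralFamily

variable [CompleteSpace E] [MeasurableSpace X] {Φ : C(X, ℂ) →⋆ₐ[ℂ] (E →L[ℂ] E)} {ψ : E}
  {ν : Measure X} {P : Set X → E}

theorem isOrthogonallyScattered (hP : IsSpectralFamily Φ ψ ν P) :
    IsOrthogonallyScattered ν P := by
  intro B C hB hC
  simpa using hP.inner_apply hB hC 1

theorem apply_eq_zero (hP : IsSpectralFamily Φ ψ ν P) {B : Set X}
    (hB : MeasurableSet B) {f : C(X, ℂ)} (hf : ∀ᵐ x ∂ν, x ∈ B → f x = 0) : Φ f (P B) = 0 := by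
  have h := inner_starAlgHom_star_mul_self Φ (P B) f
  rw [hP.inner_apply hB hB, Set.inter_self, setIntegral_eq_zero_of_ae_eq_zero] at h
  · simpa using h.symm
  · filter_upwards [hf] with x hx hxB
    simp [hx hxB]

end IsSpectralFamily

section Riesz

open ComplexOrder CompactlySupported

/-- The inclusion of the real-valued into the complex-valued continuous functions. -/
def ofRealMap : C(X, ℝ) →L[ℝ] C(X, ℂ) := Complex.ofRealCLM.compLeftContinuous ℝ X

theorem im_apply_ofRealMap_eq_zero {Λ : C(X, ℂ) →ₗ[ℂ] ℂ} (hΛ : ∀ f, 0 ≤ Λ (star f * f))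
    (f : C(X, ℝ)) : (Λ (ofRealMap f)).im = 0 := by
  have h : ofRealMap f = star (ofRealMap ((1 / 2 : ℝ) • (f + 1))) *
      ofRealMap ((1 / 2 : ℝ) • (f + 1)) - star (ofRealMap ((1 / 2 : ℝ) • (f - 1))) *
      ofRealMap ((1 / 2 : ℝ) • (f - 1)) := by
    ext x
    simp [ofRealMap]
    ring
  rw [h, map_sub, Complex.sub_im, ← (Complex.nonneg_iff.mp (hΛ _)).2,
    ← (Complex.nonneg_iff.mp (hΛ _)).2, sub_self]

theorem re_apply_ofRealMap_nonneg {Λ : C(X, ℂ) →ₗ[ℂ] ℂ} (hΛ : ∀ f, 0 ≤ Λ (star f * f))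
    {f : C(X, ℝ)} (hf : 0 ≤ f) : 0 ≤ (Λ (ofRealMap f)).re := by
  let g : C(X, ℝ) := ⟨fun x => √(f x), by fun_prop⟩
  have h : ofRealMap f = star (ofRealMap g) * ofRealMap g := by
    ext x
    have hx : f x = √(f x) * √(f x) := (Real.mul_self_sqrt (hf x)).symm
    simpa [ofRealMap, g] using mod_cast hx
  rw [h]
  exact (Complex.nonneg_iff.mp (hΛ _)).1

theorem exists_measure_integral_eq [CompactSpace X] [T2Space X] [MeasurableSpace X]
    [BorelSpace X] {Λ : C(X, ℂ) →ₗ[ℂ] ℂ}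
    (hΛ : ∀ f, 0 ≤ Λ (star f * f)) :
    ∃ ν : Measure X, IsFiniteMeasure ν ∧ ν.Regular ∧ ∀ f : C(X, ℂ), ∫ x, f x ∂ν = Λ f := by
  let L : C_c(X, ℝ) →ₗ[ℝ] ℝ :=
    { toFun := fun f => (Λ (ofRealMap f.toContinuousMap)).re
      map_add' := fun f g => by
        rw [← Complex.add_re, ← map_add, ← map_add]; rfl
      map_smul' := fun c f => by
        rw [RingHom.id_apply, smul_eq_mul, ← Complex.re_ofReal_mul, ← smul_eq_mul, ← map_smul,
          Complex.coe_smul, ← map_smul]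
        rfl }
  let ν := RealRMK.rieszMeasure (PositiveLinearMap.mk₀ L fun f hf =>
    re_apply_ofRealMap_nonneg hΛ (f := f.toContinuousMap) hf)
  have hreal : ∀ f : C(X, ℝ), ((∫ x, f x ∂ν : ℝ) : ℂ) = Λ (ofRealMap f) := by
    refine fun f => Complex.ext ?_ (im_apply_ofRealMap_eq_zero hΛ f).symm
    exact RealRMK.integral_rieszMeasure _ (⟨f, HasCompactSupport.of_compactSpace f⟩ : C_c(X, ℝ))
  refine ⟨ν, inferInstance, inferInstance, fun f => ?_⟩
  let fre : C(X, ℝ) := ⟨fun x => (f x).re, by fun_prop⟩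
  let fim : C(X, ℝ) := ⟨fun x => (f x).im, by fun_prop⟩
  have hf : f = ofRealMap fre + Complex.I • ofRealMap fim := by
    ext x
    simp [ofRealMap, fre, fim, mul_comm Complex.I]
  have hint : Integrable f ν :=
    f.continuous.integrable_of_hasCompactSupport (HasCompactSupport.of_compactSpace f)
  calc ∫ x, f x ∂ν = ((∫ x, fre x ∂ν : ℝ) : ℂ) + ((∫ x, fim x ∂ν : ℝ) : ℂ) * Complex.I :=
        (integral_re_add_im (𝕜 := ℂ) hint).symm
    _ = Λ (ofRealMap fre + Complex.I • ofRealMap fim) := by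
        rw [hreal, hreal, map_add, map_smul, smul_eq_mul, mul_comm Complex.I]
    _ = Λ f := by rw [← hf]

end Riesz

variable [CompactSpace X] [MeasurableSpace X] [BorelSpace X] {ν : Measure X} [IsFiniteMeasure ν]

open scoped ENNReal in
/-- Multiplication by a continuous function as an operator on `L²(ν)`. -/
def mulL2 (ν : Measure X) [IsFiniteMeasure ν] (f : C(X, ℂ)) : Lp ℂ 2 ν →L[ℂ] Lp ℂ 2 ν :=
  (ContinuousLinearMap.mul ℂ ℂ).holderL ν ∞ 2 2 (ContinuousMap.toLp ∞ ν ℂ f)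

open scoped ENNReal in
theorem coeFn_mulL2 (f : C(X, ℂ)) (u : Lp ℂ 2 ν) : mulL2 ν f u =ᵐ[ν] fun x => f x * u x := by
  have h : mulL2 ν f u =ᵐ[ν] _ := ContinuousLinearMap.coeFn_holder (ContinuousLinearMap.mul ℂ ℂ)
    (ContinuousMap.toLp ∞ ν ℂ f : Lp ℂ ∞ ν) u
  filter_upwards [h, ContinuousMap.coeFn_toLp (p := ∞) (𝕜 := ℂ) ν f] with x hx hf
  rw [hx, hf]
  rfl

theorem mulL2_toLp (f g : C(X, ℂ)) :
    mulL2 ν f (ContinuousMap.toLp 2 ν ℂ g) = ContinuousMap.toLp 2 ν ℂ (f * g) := by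
  apply Lp.ext
  filter_upwards [coeFn_mulL2 f (ContinuousMap.toLp 2 ν ℂ g),
    ContinuousMap.coeFn_toLp (p := 2) (𝕜 := ℂ) ν g,
    ContinuousMap.coeFn_toLp (p := 2) (𝕜 := ℂ) ν (f * g)] with x hfg hg h
  rw [hfg, hg, h, ContinuousMap.mul_apply]

theorem exists_linearIsometry_of_norm_eq {F G : Type*} [AddCommGroup F] [Module ℂ F]
    [NormedAddCommGroup G] [NormedSpace ℂ G] [CompleteSpace E] {f : F →ₗ[ℂ] E} {e : F →ₗ[ℂ] G}
    (he : DenseRange e) (h : ∀ x, ‖f x‖ = ‖e x‖) : ∃ W : G →ₗᵢ[ℂ] E, ∀ x, W (e x) = f x := by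
  have hW : ∀ x, f.extendOfNorm e (e x) = f x :=
    LinearMap.extendOfNorm_eq he ⟨1, fun x => by rw [one_mul, h]⟩
  have hnorm : ∀ u, ‖f.extendOfNorm e u‖ = ‖u‖ :=
    congrFun (he.equalizer (by fun_prop) (by fun_prop) (funext fun x => by
      rw [Function.comp_apply, Function.comp_apply, hW, h]))
  exact ⟨⟨(f.extendOfNorm e).toLinearMap, hnorm⟩, hW⟩

variable [T2Space X] [CompleteSpace E]

open ComplexOrder in
theorem exists_linearIsometry_apply_toLp (Φ : C(X, ℂ) →⋆ₐ[ℂ] (E →L[ℂ] E)) (ψ : E) :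
    ∃ ν : Measure X, ∃ _ : IsFiniteMeasure ν, ν.Regular ∧ ∃ W : Lp ℂ 2 ν →ₗᵢ[ℂ] E,
      ∀ f, W (ContinuousMap.toLp 2 ν ℂ f) = Φ f ψ := by
  let orbit : C(X, ℂ) →ₗ[ℂ] E :=
    (ContinuousLinearMap.apply ℂ E ψ).toLinearMap ∘ₗ Φ.toAlgHom.toLinearMap
  have horbit : ∀ f, orbit f = Φ f ψ := fun _ => rfl
  obtain ⟨ν, hfin, hreg, hν⟩ := exists_measure_integral_eq
    (Λ := (innerSL ℂ ψ).toLinearMap ∘ₗ orbit) fun f => by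
      rw [LinearMap.comp_apply, horbit, ContinuousLinearMap.coe_coe, innerSL_apply_apply,
        inner_starAlgHom_star_mul_self, ← Complex.ofReal_pow, Complex.zero_le_real]
      positivity
  have hnorm : ∀ f, ‖orbit f‖ = ‖ContinuousMap.toLp 2 ν ℂ f‖ := by
    intro f
    rw [← sq_eq_sq₀ (norm_nonneg _) (norm_nonneg _), ← Complex.ofReal_inj, Complex.ofReal_pow,
      Complex.ofReal_pow]
    calc (‖Φ f ψ‖ : ℂ) ^ 2 = ∫ x, (star f * f) x ∂ν := by
          rw [hν, ← inner_starAlgHom_star_mul_self]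
          rfl
      _ = inner ℂ (ContinuousMap.toLp 2 ν ℂ f) (ContinuousMap.toLp 2 ν ℂ f) := by
          rw [ContinuousMap.inner_toLp]
          exact integral_congr_ae (.of_forall fun x => mul_comm _ _)
      _ = _ := inner_self_eq_norm_sq_to_K _
  exact ⟨ν, hfin, hreg, exists_linearIsometry_of_norm_eq
    (ContinuousMap.toLp_denseRange (p := 2) ℂ ν ℂ (by simp)) hnorm⟩

theorem apply_linearIsometry_eq_apply_mulL2 [ν.WeaklyRegular]
    {Φ : C(X, ℂ) →⋆ₐ[ℂ] (E →L[ℂ] E)} {ψ : E} {W : Lp ℂ 2 ν →ₗᵢ[ℂ] E}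
    (hW : ∀ f, W (ContinuousMap.toLp 2 ν ℂ f) = Φ f ψ) (f : C(X, ℂ)) (u : Lp ℂ 2 ν) :
    Φ f (W u) = W (mulL2 ν f u) := by
  have hdense := ContinuousMap.toLp_denseRange (p := 2) ℂ ν ℂ (by simp)
  refine congrFun (hdense.equalizer (g := fun u => Φ f (W u)) (h := fun u => W (mulL2 ν f u))
    ((Φ f).continuous.comp W.continuous) (W.continuous.comp (mulL2 ν f).continuous)
    (funext fun g => ?_)) u
  calc Φ f (W (ContinuousMap.toLp 2 ν ℂ g)) = Φ f (Φ g ψ) := by rw [hW]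
    _ = Φ (f * g) ψ := by rw [map_mul, mul_apply_eq_comp]
    _ = W (mulL2 ν f (ContinuousMap.toLp 2 ν ℂ g)) := by rw [mulL2_toLp, hW]

open scoped Classical in
theorem exists_isSpectralFamily (Φ : C(X, ℂ) →⋆ₐ[ℂ] (E →L[ℂ] E)) (ψ : E) :
    ∃ ν : Measure X, IsFiniteMeasure ν ∧ ∃ P, IsSpectralFamily Φ ψ ν P := by
  obtain ⟨ν, hfin, hreg, W, hW⟩ := exists_linearIsometry_apply_toLp Φ ψ
  let P : Set X → E := fun B => if hB : MeasurableSet B then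
    W (indicatorConstLp 2 hB (measure_ne_top ν B) 1) else 0
  have hP : ∀ {B} (hB : MeasurableSet B), P B =
      W (indicatorConstLp 2 hB (measure_ne_top ν B) 1) := fun hB => dif_pos hB
  refine ⟨ν, hfin, P, ?_, fun B C hB hC f => ?_⟩
  · have hone : indicatorConstLp 2 .univ (measure_ne_top ν Set.univ) (1 : ℂ) =
        ContinuousMap.toLp 2 ν ℂ 1 := by
      rw [indicatorConstLp_univ]
      apply Lp.ext
      filter_upwards [Lp.coeFn_const 2 ν (1 : ℂ),
        ContinuousMap.coeFn_toLp (p := 2) (𝕜 := ℂ) ν (1 : C(X, ℂ))] with x h₁ h₂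
      rw [h₁, h₂]
      rfl
    rw [hP .univ, hone, hW, map_one, one_apply_eq_self]
  rw [hP hB, hP hC, apply_linearIsometry_eq_apply_mulL2 hW, W.inner_map_map,
    L2.inner_indicatorConstLp_one, ← setIntegral_indicator hC]
  refine integral_congr_ae (ae_restrict_of_ae ?_)
  filter_upwards [coeFn_mulL2 f _, indicatorConstLp_coeFn (p := 2) (hs := hC)
    (hμs := measure_ne_top ν C) (c := (1 : ℂ))] with x hf hx
  rw [hf, hx]
  by_cases hxC : x ∈ C <;> simp [hxC]

end FunctionalCalculus

section SpectralTheorem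

variable {E : Type*} [NormedAddCommGroup E] [InnerProductSpace ℂ E]

/-- The circle of the numbers `(λ - i)⁻¹`, `λ ∈ ℝ`, together with `0`.  It contains the spectrum of
the resolvent at `i` of a self-adjoint operator. -/
def resolventCircle : Set ℂ := {x | x - conj x = 2 * Complex.I * (x * conj x)}

/-- The `λ` with `x = (λ - i)⁻¹`, for `x ≠ 0` on the resolvent circle. -/
def energy (x : ℂ) : ℝ := (x⁻¹).re

theorem measurable_energy : Measurable energy := by
  unfold energy
  fun_prop

theorem ofReal_energy {x : ℂ} (hx : x ∈ resolventCircle) (hx0 : x ≠ 0) :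
    (energy x : ℂ) = x⁻¹ + Complex.I := by
  have hx' : conj x ≠ 0 := (map_ne_zero _).mpr hx0
  have h : x⁻¹ - conj x⁻¹ = -(2 * Complex.I) := by
    rw [map_inv₀]
    have hcirc : x - conj x = 2 * Complex.I * (x * conj x) := hx
    field_simp
    linear_combination -hcirc
  have him : (x⁻¹).im = -1 := by
    have h' := congrArg Complex.im h
    simp only [Complex.sub_im, Complex.conj_im, Complex.neg_im, Complex.mul_im, Complex.re_ofNat,
      Complex.I_im, Complex.im_ofNat, Complex.I_re] at h'
    linarith
  apply Complex.ext <;> simp [energy, him]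

theorem inv_ofReal_energy_sub {x : ℂ} (hx : x ∈ resolventCircle) (hx0 : x ≠ 0) (z : ℂ) :
    ((energy x : ℂ) - z)⁻¹ = x / (1 + (Complex.I - z) * x) := by
  rw [ofReal_energy hx hx0, ← inv_div]
  congr 1
  field_simp
  ring

theorem one_add_mul_ne_zero {x : ℂ} (hx : x ∈ resolventCircle) {z : ℂ} (hz : z.im ≠ 0) :
    1 + (Complex.I - z) * x ≠ 0 := by
  rcases eq_or_ne x 0 with rfl | hx0
  · simp
  intro h
  have h' : (energy x : ℂ) = z := by
    rw [ofReal_energy hx hx0]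
    field_simp
    linear_combination h
  exact hz (by rw [← h', Complex.ofReal_im])

variable {A : E →ₗ.[ℂ] E} {z : ℂ} {R : E →L[ℂ] E}

theorem IsResolventAt.mem_eigenspace (hR : IsResolventAt A z R) {a : ℂ} (ha : a ≠ z) {u : E}
    (hu : R u = (a - z)⁻¹ • u) : u ∈ eigenspace A a := by
  have h := A.graph.smul_mem (a - z) (hR.mem_graph u)
  rw [Prod.smul_mk, smul_add, smul_comm _ z, hu, smul_inv_smul₀ (sub_ne_zero.mpr ha), ← add_smul,
    sub_add_cancel] at h
  exact mem_eigenspace_iff.mpr h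

/-- The coordinate function of `C(σ(R), ℂ)`. -/
def spectrumCoe (R : E →L[ℂ] E) : C(_root_.spectrum ℂ R, ℂ) :=
  (ContinuousMap.id ℂ).restrict (_root_.spectrum ℂ R)

/-- The map `x ↦ λ` with `x = (λ - i)⁻¹` on the spectrum of the resolvent `R` at `i`. -/
def spectrumEnergy (R : E →L[ℂ] E) : _root_.spectrum ℂ R → ℝ :=
  (_root_.spectrum ℂ R).domRestrict energy

theorem measurable_spectrumEnergy (R : E →L[ℂ] E) : Measurable (spectrumEnergy R) :=
  measurable_energy.comp measurable_subtype_coe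

variable [CompleteSpace E]

theorem IsResolventAt.star_eq (hA : A.IsFormalAdjoint A) (hR : IsResolventAt A z R)
    {S : E →L[ℂ] E} (hS : IsResolventAt A (conj z) S) : star R = S :=
  ((ContinuousLinearMap.eq_adjoint_iff S R).mpr (hR.inner_left hA hS)).symm

theorem isSpectralMeasure_of_forall_isResolventAt (hA : IsSelfAdjoint A) {ψ : E} {μ : Measure ℝ}
    [IsFiniteMeasure μ] (h : ∀ z S, z.im ≠ 0 → IsResolventAt A z S →
      inner ℂ ψ (S ψ) = ∫ l : ℝ, ((l : ℂ) - z)⁻¹ ∂μ) : IsSpectralMeasure A ψ μ := by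
  refine ⟨inferInstance, fun z hz => ?_⟩
  obtain ⟨S, hS⟩ := exists_isResolventAt_of_im_ne_zero hA hz
  obtain ⟨hmem, hval⟩ := mem_graph_iff_exists_apply_eq.mp (hS.mem_graph ψ)
  exact ⟨⟨S ψ, hmem⟩, by rw [hval, add_sub_cancel_right], h z S hz hS⟩

theorem exists_isResolventAt_I (hA : IsSelfAdjoint A) :
    ∃ R, IsResolventAt A Complex.I R ∧ IsStarNormal R ∧
      R - star R = (2 * Complex.I) • (R * star R) := by
  obtain ⟨R, hR⟩ := exists_isResolventAt_of_im_ne_zero hA (z := Complex.I) (by simp)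
  obtain ⟨S, hS⟩ := exists_isResolventAt_of_im_ne_zero hA (z := conj Complex.I) (by simp)
  have hI : Complex.I - conj Complex.I = 2 * Complex.I := by rw [Complex.conj_I]; ring
  have hRS : R - S = (2 * Complex.I) • (R * S) := hI ▸ hR.sub_eq hS
  have hSR : R - S = (2 * Complex.I) • (S * R) := by
    rw [← hI, ← neg_sub S R, hS.sub_eq hR, ← neg_smul, neg_sub]
  rw [← hR.star_eq (isFormalAdjoint_of_isSelfAdjoint hA) hS] at hRS hSR
  exact ⟨R, hR, ⟨smul_right_injective _ (by simp : 2 * Complex.I ≠ 0) (hSR.symm.trans hRS)⟩, hRS⟩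

theorem cfcHom_spectrumCoe (hnormal : IsStarNormal R) : cfcHom hnormal (spectrumCoe R) = R :=
  cfcHom_id hnormal

theorem spectrum_subset_resolventCircle (hnormal : IsStarNormal R)
    (h : R - star R = (2 * Complex.I) • (R * star R)) :
    _root_.spectrum ℂ R ⊆ resolventCircle := by
  intro x hx
  have hcoe : spectrumCoe R - star (spectrumCoe R) =
      (2 * Complex.I) • (spectrumCoe R * star (spectrumCoe R)) := by
    apply cfcHom_injective hnormal
    simp only [map_sub, map_smul, map_mul, map_star, cfcHom_spectrumCoe, h]
  exact congrArg (fun f : C(_root_.spectrum ℂ R, ℂ) => f ⟨x, hx⟩) hcoe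

theorem IsResolventAt.cfcHom_eq (hR : IsResolventAt A Complex.I R) (hnormal : IsStarNormal R)
    {S : E →L[ℂ] E} (hS : IsResolventAt A z S) {g : C(_root_.spectrum ℂ R, ℂ)}
    (hg : ∀ x : _root_.spectrum ℂ R, 1 + (Complex.I - z) * (x : ℂ) ≠ 0 ∧
      g x = (x : ℂ) / (1 + (Complex.I - z) * (x : ℂ))) :
    cfcHom hnormal g = S := by
  have hmul : (1 - (z - Complex.I) • spectrumCoe R) * g = spectrumCoe R := by
    ext x
    change (1 - (z - Complex.I) * (x : ℂ)) * g x = x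
    rw [(hg x).2, ← neg_sub Complex.I z, neg_mul, sub_neg_eq_add, mul_div_cancel₀ _ (hg x).1]
  have h := congrArg (cfcHom hnormal) hmul
  rw [map_mul, map_sub, map_one, map_smul, cfcHom_spectrumCoe] at h
  refine (hR.isUnit_one_sub_smul hS).mul_left_cancel (h.trans ?_)
  have hsub := hR.sub_eq hS
  rw [sub_mul, one_mul, smul_mul_assoc, ← neg_sub Complex.I z, neg_smul, sub_neg_eq_add, ← hsub,
    add_sub_cancel]

variable {hnormal : IsStarNormal R} {ψ : E} {ν : Measure (_root_.spectrum ℂ R)}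
  {P : Set (_root_.spectrum ℂ R) → E}

theorem IsSpectralFamily.ae_coe_ne_zero (hR : IsResolventAt A z R)
    (hP : IsSpectralFamily (cfcHom hnormal) ψ ν P) [IsFiniteMeasure ν] :
    ∀ᵐ x : _root_.spectrum ℂ R ∂ν, (x : ℂ) ≠ 0 := by
  have hm : MeasurableSet {x : _root_.spectrum ℂ R | (x : ℂ) = 0} :=
    measurable_subtype_coe (measurableSet_singleton 0)
  have h : cfcHom hnormal (spectrumCoe R) (P {x | (x : ℂ) = 0}) = 0 :=
    hP.apply_eq_zero hm (.of_forall fun x hx => hx)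
  rw [cfcHom_spectrumCoe, hR.apply_eq_zero_iff] at h
  have hν := hP.isOrthogonallyScattered hm hm
  rw [h, inner_zero_left, Set.inter_self, eq_comm, Complex.ofReal_eq_zero,
    measureReal_eq_zero_iff] at hν
  simpa [ae_iff] using hν

theorem IsSpectralFamily.apply_preimage_singleton_mem_eigenspace
    (hR : IsResolventAt A Complex.I R) (hcirc : _root_.spectrum ℂ R ⊆ resolventCircle)
    (hP : IsSpectralFamily (cfcHom hnormal) ψ ν P) [IsFiniteMeasure ν] (a : ℝ) :
    P (spectrumEnergy R ⁻¹' {a}) ∈ eigenspace A a := by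
  have hl := measurable_spectrumEnergy R
  have h : cfcHom hnormal (spectrumCoe R - algebraMap ℂ _ ((a : ℂ) - Complex.I)⁻¹)
      (P (spectrumEnergy R ⁻¹' {a})) = 0 := by
    refine hP.apply_eq_zero (hl (measurableSet_singleton a)) ?_
    filter_upwards [hP.ae_coe_ne_zero hR] with x hx hxa
    have hax : (a : ℂ) = (x : ℂ)⁻¹ + Complex.I := by
      rw [← ofReal_energy (hcirc x.2) hx, show energy x = a from hxa]
    simp [spectrumCoe, hax]
  rw [map_sub, cfcHom_spectrumCoe, AlgHomClass.commutes, Algebra.algebraMap_eq_smul_one,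
    _root_.sub_apply, _root_.smul_apply, one_apply_eq_self, sub_eq_zero] at h
  exact hR.mem_eigenspace (fun h => by simpa using congrArg Complex.im h) h

theorem IsSpectralFamily.isSpectralMeasure (hA : IsSelfAdjoint A)
    (hR : IsResolventAt A Complex.I R) (hcirc : _root_.spectrum ℂ R ⊆ resolventCircle)
    (hP : IsSpectralFamily (cfcHom hnormal) ψ ν P) [IsFiniteMeasure ν] {B : Set ℝ}
    (hB : MeasurableSet B) :
    IsSpectralMeasure A (P (spectrumEnergy R ⁻¹' B))
      ((ν.map (spectrumEnergy R)).restrict B) := by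
  have hl := measurable_spectrumEnergy R
  refine isSpectralMeasure_of_forall_isResolventAt hA fun z S hz hS => ?_
  have hden : ∀ x : _root_.spectrum ℂ R, 1 + (Complex.I - z) * (x : ℂ) ≠ 0 := fun x =>
    one_add_mul_ne_zero (hcirc x.2) hz
  let g : C(_root_.spectrum ℂ R, ℂ) :=
    ⟨fun x => (x : ℂ) / (1 + (Complex.I - z) * (x : ℂ)), by fun_prop (disch := exact hden)⟩
  rw [← hR.cfcHom_eq hnormal hS (g := g) fun x => ⟨hden x, rfl⟩, hP.inner_apply (hl hB) (hl hB),
    Set.inter_self, Measure.restrict_map hl hB, integral_map hl.aemeasurable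
      (Measurable.aestronglyMeasurable (by fun_prop))]
  refine integral_congr_ae (ae_restrict_of_ae ?_)
  filter_upwards [hP.ae_coe_ne_zero hR] with x hx
  exact (inv_ofReal_energy_sub (hcirc x.2) hx z).symm

/-- `P B = E_A(B)ψ`, where `E_A` is the projection-valued measure of the self-adjoint operator `A`,
and `μ` is the spectral measure of `ψ`. -/
structure IsSpectralResolution (A : E →ₗ.[ℂ] E) (ψ : E) (μ : Measure ℝ) (P : Set ℝ → E) :
    Prop where
  univ : P Set.univ = ψ
  isOrthogonallyScattered : IsOrthogonallyScattered μ P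
  isSpectralMeasure : ∀ ⦃B : Set ℝ⦄, MeasurableSet B →
    IsSpectralMeasure A (P B) (μ.restrict B)
  singleton_mem : ∀ a : ℝ, P {a} ∈ eigenspace A a

theorem exists_isSpectralResolution (hA : IsSelfAdjoint A) (ψ : E) :
    ∃ μ : Measure ℝ, IsFiniteMeasure μ ∧ ∃ P, IsSpectralResolution A ψ μ P := by
  obtain ⟨R, hR, hnormal, hstar⟩ := exists_isResolventAt_I hA
  have hcirc := spectrum_subset_resolventCircle hnormal hstar
  obtain ⟨ν, hfin, P, hP⟩ := exists_isSpectralFamily (cfcHom hnormal) ψ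
  have hl := measurable_spectrumEnergy R
  refine ⟨ν.map (spectrumEnergy R), inferInstance, fun B => P (spectrumEnergy R ⁻¹' B),
    hP.univ, fun B C hB hC => ?_, fun B hB => hP.isSpectralMeasure hA hR hcirc hB,
    hP.apply_preimage_singleton_mem_eigenspace hR hcirc⟩
  rw [hP.isOrthogonallyScattered (hl hB) (hl hC), map_measureReal_apply hl (hB.inter hC),
    Set.preimage_inter]

theorem exists_countable_restrict_absolutelyContinuous_mutuallySingular (μ : Measure ℝ)
    [IsFiniteMeasure μ] :
    ∃ S N : Set ℝ, S.Countable ∧ MeasurableSet N ∧ μ.restrict (N \ S) ≪ volume ∧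
      (∀ x, μ.restrict (Nᶜ \ S) {x} = 0) ∧ μ.restrict (Nᶜ \ S) ⟂ₘ volume := by
  have hS : {x | 0 < μ {x}}.Countable := Measure.countable_meas_level_set_pos measurable_id
  have hsing := Measure.mutuallySingular_singularPart μ volume
  refine ⟨{x | 0 < μ {x}}, hsing.nullSet, hS, hsing.measurableSet_nullSet, ?_, fun x => ?_,
    hsing.nullSet, hsing.measurableSet_nullSet, ?_, hsing.measure_compl_nullSet⟩
  · refine Measure.AbsolutelyContinuous.mk fun s hs h0 => ?_
    have hμ : ∀ B, μ B = μ.singularPart volume B + volume.withDensity (μ.rnDeriv volume) B :=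
      fun B => by rw [← Measure.add_apply, Measure.singularPart_add_rnDeriv]
    rw [Measure.restrict_apply hs, hμ,
      measure_mono_null (Set.inter_subset_right.trans Set.sdiff_subset) hsing.measure_nullSet,
      measure_mono_null Set.inter_subset_left (withDensity_absolutelyContinuous _ _ h0), add_zero]
  · rw [Measure.restrict_apply (measurableSet_singleton x)]
    by_cases hx : 0 < μ {x}
    · convert measure_empty (μ := μ)
      exact Set.singleton_inter_eq_empty.mpr fun h => h.2 hx
    · exact measure_mono_null Set.inter_subset_left (nonpos_iff_eq_zero.mp (not_lt.mp hx))
  · rw [Measure.restrict_apply hsing.measurableSet_nullSet]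
    convert measure_empty (μ := μ)
    exact (disjoint_compl_right.mono_right Set.sdiff_subset).inter_eq

theorem acSubspace_sup_scSubspace_sup_ppSubspace (hA : IsSelfAdjoint A) :
    acSubspace A ⊔ scSubspace A ⊔ ppSubspace A = ⊤ := by
  rw [Submodule.eq_top_iff']
  intro ψ
  obtain ⟨μ, hfin, P, hP⟩ := exists_isSpectralResolution hA ψ
  obtain ⟨S, N, hS, hN, hac, hatom, hsing⟩ :=
    exists_countable_restrict_absolutelyContinuous_mutuallySingular μ
  have hSm := hS.measurableSet
  have hP_ac : P (N \ S) ∈ acSubspace A := Submodule.le_topologicalClosure _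
    (Submodule.subset_span ⟨_, hP.isSpectralMeasure (hN.diff hSm), hac⟩)
  have hP_sc : P (Nᶜ \ S) ∈ scSubspace A := Submodule.le_topologicalClosure _
    (Submodule.subset_span ⟨_, hP.isSpectralMeasure (hN.compl.diff hSm), hatom, hsing⟩)
  have hP_pp : P S ∈ ppSubspace A := hP.isOrthogonallyScattered.mem_of_countable
    (Submodule.isClosed_topologicalClosure _) hS fun a _ =>
      Submodule.le_topologicalClosure _ (Submodule.mem_iSup_of_mem _ (hP.singleton_mem a))
  have hdisj : Disjoint (N \ S) (Nᶜ \ S) :=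
    disjoint_compl_right.mono Set.sdiff_subset Set.sdiff_subset
  have hunion : ψ = P (N \ S) + P (Nᶜ \ S) + P S := by
    rw [← hP.isOrthogonallyScattered.union (hN.diff hSm) (hN.compl.diff hSm) hdisj,
      ← Set.union_sdiff_distrib, Set.union_compl_self,
      ← hP.isOrthogonallyScattered.union (MeasurableSet.univ.diff hSm) hSm
        Set.disjoint_sdiff_left, Set.sdiff_union_self, Set.univ_union, hP.univ]
  rw [hunion]
  exact Submodule.add_mem_sup (Submodule.add_mem_sup hP_ac hP_sc) hP_pp

end SpectralTheorem

section StrongTimeOperators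

variable {E : Type*} [NormedAddCommGroup E] [InnerProductSpace ℂ E]

/-- The weak Weyl relation `T U(t) = U(t) (T + t)` on `D(T)`, where `U t = e^{-itA}`. -/
def WeakWeylRelation (U : ℝ → E →L[ℂ] E) (T : E →ₗ.[ℂ] E) : Prop :=
  ∀ (t : ℝ) ⦃x y : E⦄, (x, y) ∈ T.graph → (U t x, U t (y + (t : ℂ) • x)) ∈ T.graph

theorem isStrongTimeOperator_iff [CompleteSpace E] {A T : E →ₗ.[ℂ] E} :
    IsStrongTimeOperator A T ↔ IsSelfAdjoint A ∧ IsSymmetricOp T ∧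
      ∃ U, IsUnitaryGroup A U ∧ WeakWeylRelation U T := by
  simp only [IsStrongTimeOperator, WeakWeylRelation, mem_graph_iff_exists_apply_eq]
  refine and_congr_right' (and_congr_right' (exists_congr fun U => and_congr_right' ⟨?_, ?_⟩))
  · rintro h t x _ ⟨hx, rfl⟩
    exact h t ⟨x, hx⟩
  · exact fun h t x => h t ⟨x.2, rfl⟩

section Closure

variable [CompleteSpace E] {T : E →ₗ.[ℂ] E}

theorem IsSymmetricOp.isClosable (hT : IsSymmetricOp T) : T.IsClosable :=
  LinearPMap.isClosable_iff_exists_closed_extension.mpr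
    ⟨T.adjoint, LinearPMap.adjoint_isClosed hT.1, LinearPMap.IsFormalAdjoint.le_adjoint hT.1 hT.2⟩

theorem IsSymmetricOp.mem_graph_closure_iff (hT : IsSymmetricOp T) {p : E × E} :
    p ∈ T.closure.graph ↔ p ∈ _root_.closure (T.graph : Set (E × E)) := by
  rw [← hT.isClosable.graph_closure_eq_closure_graph]
  rfl

theorem IsSymmetricOp.closure (hT : IsSymmetricOp T) : IsSymmetricOp T.closure := by
  refine ⟨hT.1.mono T.le_closure.1, isFormalAdjoint_iff_forall_mem_graph.mpr ?_⟩
  intro x y x' y' hx hx'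
  have h := map_mem_closure₂ (u := {0}) (f := fun p q : E × E => inner ℂ p.2 q.1 - inner ℂ p.1 q.2)
    (by fun_prop) (hT.mem_graph_closure_iff.mp hx) (hT.mem_graph_closure_iff.mp hx')
    fun p hp q hq => sub_eq_zero.mpr (isFormalAdjoint_iff_forall_mem_graph.mp hT.2 hp hq)
  rw [closure_singleton] at h
  exact sub_eq_zero.mp h

theorem IsStrongTimeOperator.closure {A : E →ₗ.[ℂ] E} (hT : IsStrongTimeOperator A T) :
    IsStrongTimeOperator A T.closure := by
  obtain ⟨hA, hs, U, hU, hUT⟩ := isStrongTimeOperator_iff.mp hT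
  refine isStrongTimeOperator_iff.mpr ⟨hA, hs.closure, U, hU, fun t x y hxy => ?_⟩
  rw [hs.mem_graph_closure_iff] at hxy ⊢
  exact map_mem_closure (f := fun p : E × E => (U t p.1, U t (p.2 + (t : ℂ) • p.1)))
    (by fun_prop) hxy fun p hp => hUT t hp

theorem IsStrongTimeOperator.exists_isClosed {A : E →ₗ.[ℂ] E} (hT : IsStrongTimeOperator A T) :
    ∃ S, IsStrongTimeOperator A S ∧ S.IsClosed :=
  ⟨T.closure, hT.closure, hT.2.1.isClosable.closure_isClosed⟩

end Closure

theorem integral_mem_of_isClosed {α F : Type*} [MeasurableSpace α] {μ : Measure α}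
    [NormedAddCommGroup F] [NormedSpace ℂ F] [CompleteSpace F] {K : Submodule ℂ F}
    (hK : IsClosed (K : Set F)) {g : α → F} (hg : Integrable g μ) (hgK : ∀ t, g t ∈ K) :
    ∫ t, g t ∂μ ∈ K := by
  have : IsClosed (K.toAddSubgroup : Set F) := hK
  have hzero : ∀ t, K.mkQL (g t) = 0 := fun t => (Submodule.Quotient.mk_eq_zero K).mpr (hgK t)
  rw [← Submodule.Quotient.mk_eq_zero]
  change K.mkQL _ = 0
  rw [← K.mkQL.integral_comp_comm hg]
  simp only [hzero, integral_zero]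

/-- `∫ f(t) e^{itA} ψ dt`, where `U t = e^{-itA}`. -/
def smear (U : ℝ → E →L[ℂ] E) (f : ℝ → ℝ) (ψ : E) : E := ∫ t, f t • U (-t) ψ

theorem smear_eq_convolution (U : ℝ → E →L[ℂ] E) (f : ℝ → ℝ) (ψ : E) :
    smear U f ψ = convolution f (fun t => U t ψ) (ContinuousLinearMap.lsmul ℝ ℝ) volume 0 := by
  simp [smear, convolution]

variable {A T : E →ₗ.[ℂ] E} {U : ℝ → E →L[ℂ] E} {f g : ℝ → ℝ}

namespace IsUnitaryGroup

theorem integrable_smear (hU : IsUnitaryGroup A U) (hf : Continuous f) (hfs : HasCompactSupport f)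
    (ψ : E) : Integrable fun t => f t • U (-t) ψ :=
  (hf.smul ((hU.continuous ψ).comp continuous_neg)).integrable_of_hasCompactSupport hfs.smul_right

theorem smear_add (hU : IsUnitaryGroup A U) (hf : Continuous f) (hfs : HasCompactSupport f)
    (hg : Continuous g) (hgs : HasCompactSupport g) (ψ : E) :
    smear U (fun t => f t + g t) ψ = smear U f ψ + smear U g ψ := by
  simp only [smear, add_smul]
  exact integral_add (hU.integrable_smear hf hfs ψ) (hU.integrable_smear hg hgs ψ)

variable [CompleteSpace E]

theorem apply_smear (hU : IsUnitaryGroup A U) (hf : Continuous f) (hfs : HasCompactSupport f)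
    (ψ : E) (s : ℝ) : U s (smear U f ψ) =
      convolution f (fun t => U t ψ) (ContinuousLinearMap.lsmul ℝ ℝ) volume s := by
  rw [smear, ← (U s).integral_comp_comm (hU.integrable_smear hf hfs ψ), convolution]
  congr 1 with t
  rw [(U s).map_smul_of_tower, ← mul_apply_eq_comp, ← hU.map_add, ← sub_eq_add_neg,
    ContinuousLinearMap.lsmul_apply]

theorem smear_mem_graph (hU : IsUnitaryGroup A U) (hf : ContDiff ℝ 1 f)
    (hfs : HasCompactSupport f) (ψ : E) :
    (smear U f ψ, Complex.I • smear U (deriv f) ψ) ∈ A.graph := by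
  have hderiv := hfs.hasDerivAt_convolution_left (ContinuousLinearMap.lsmul ℝ ℝ) hf
    ((hU.continuous ψ).locallyIntegrable (μ := volume)) 0
  rw [mem_graph_iff_exists_apply_eq, hU.generator, smul_smul, Complex.I_mul_I, neg_one_smul,
    neg_neg, smear_eq_convolution U (deriv f)]
  simpa only [hU.apply_smear hf.continuous hfs] using hderiv

theorem smear_mem_graph_of_weakWeylRelation (hU : IsUnitaryGroup A U) (hT : T.IsClosed)
    (hUT : WeakWeylRelation U T) (hf : Continuous f) (hfs : HasCompactSupport f) {ψ η : E}
    (hψ : (ψ, η) ∈ T.graph) :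
    (smear U f ψ, smear U f η - smear U (fun t => t * f t) ψ) ∈ T.graph := by
  have hψi := hU.integrable_smear hf hfs ψ
  have hηi := hU.integrable_smear hf hfs η
  have hti : Integrable fun t => (t * f t) • U (-t) ψ :=
    hU.integrable_smear (continuous_id.mul hf) hfs.mul_left ψ
  have hmem : ∀ t, (f t • U (-t) ψ, f t • U (-t) η - (t * f t) • U (-t) ψ) ∈ T.graph := by
    intro t
    convert T.graph.smul_mem (f t : ℂ) (hUT (-t) hψ) using 1
    simp [mul_smul, smul_comm t, sub_eq_add_neg]
  have h := integral_mem_of_isClosed hT (hψi.prodMk (hηi.sub hti)) hmem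
  rwa [integral_pair hψi (hηi.sub hti), integral_sub' hηi hti] at h

end IsUnitaryGroup

/-- The largest subspace on which `A T - T A = -i`. -/
def ccrSubmodule (A T : E →ₗ.[ℂ] E) : Submodule ℂ E where
  carrier := {ψ | ∃ a b c d, (ψ, a) ∈ A.graph ∧ (ψ, b) ∈ T.graph ∧ (b, c) ∈ A.graph ∧
    (a, d) ∈ T.graph ∧ c - d = -(Complex.I • ψ)}
  zero_mem' := ⟨0, 0, 0, 0, A.graph.zero_mem, T.graph.zero_mem, A.graph.zero_mem,
    T.graph.zero_mem, by simp⟩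
  add_mem' := by
    rintro x y ⟨a, b, c, d, ha, hb, hc, hd, hcd⟩ ⟨a', b', c', d', ha', hb', hc', hd', hcd'⟩
    refine ⟨a + a', b + b', c + c', d + d', A.graph.add_mem ha ha', T.graph.add_mem hb hb',
      A.graph.add_mem hc hc', T.graph.add_mem hd hd', ?_⟩
    rw [add_sub_add_comm, hcd, hcd', smul_add, neg_add]
  smul_mem' := by
    rintro z x ⟨a, b, c, d, ha, hb, hc, hd, hcd⟩
    refine ⟨z • a, z • b, z • c, z • d, A.graph.smul_mem z ha, T.graph.smul_mem z hb,
      A.graph.smul_mem z hc, T.graph.smul_mem z hd, ?_⟩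
    rw [← smul_sub, hcd, smul_neg, smul_comm]

theorem isCCRDomain_ccrSubmodule (h : ccrSubmodule A T ≠ ⊥) :
    IsCCRDomain A T (ccrSubmodule A T) := by
  refine ⟨h, ?_⟩
  rintro ψ ⟨a, b, c, d, ha, hb, hc, hd, hcd⟩
  obtain ⟨hA, rfl⟩ := mem_graph_iff_exists_apply_eq.mp ha
  obtain ⟨hT, rfl⟩ := mem_graph_iff_exists_apply_eq.mp hb
  obtain ⟨hAT, rfl⟩ := mem_graph_iff_exists_apply_eq.mp hc
  obtain ⟨hTA, rfl⟩ := mem_graph_iff_exists_apply_eq.mp hd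
  exact ⟨hA, hT, hAT, hTA, hcd⟩

theorem deriv_mul_id (hf : Differentiable ℝ f) :
    deriv (fun t => t * f t) = fun t => f t + t * deriv f t := by
  ext t
  have h := ((hasDerivAt_id t).mul (hf t).hasDerivAt).deriv
  rwa [one_mul] at h

variable [CompleteSpace E]

theorem IsUnitaryGroup.smear_mem_ccrSubmodule (hU : IsUnitaryGroup A U) (hT : T.IsClosed)
    (hUT : WeakWeylRelation U T) (hf : ContDiff ℝ 1 f) (hfs : HasCompactSupport f) {ψ : E}
    (hψ : ψ ∈ T.domain) : smear U f ψ ∈ ccrSubmodule A T := by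
  have hψT := T.mem_graph ⟨ψ, hψ⟩
  have hd : Continuous (deriv f) := hf.continuous_deriv le_rfl
  have htf : ContDiff ℝ 1 fun t => t * f t := contDiff_id.mul hf
  have htd : Continuous fun t => t * deriv f t := continuous_id.mul hd
  refine ⟨_, _, _, _, hU.smear_mem_graph hf hfs ψ,
    hU.smear_mem_graph_of_weakWeylRelation hT hUT hf.continuous hfs hψT,
    A.graph.sub_mem (hU.smear_mem_graph hf hfs _)
      (hU.smear_mem_graph htf hfs.mul_left ψ),
    T.graph.smul_mem Complex.I
      (hU.smear_mem_graph_of_weakWeylRelation hT hUT hd hfs.deriv hψT), ?_⟩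
  rw [deriv_mul_id (hf.differentiable one_ne_zero),
    hU.smear_add hf.continuous hfs htd hfs.deriv.mul_left]
  module

open Filter Topology in
theorem IsUnitaryGroup.exists_tendsto_smear (hU : IsUnitaryGroup A U) (ψ : E) :
    ∃ f : ℕ → ℝ → ℝ, (∀ n, ContDiff ℝ 1 (f n)) ∧ (∀ n, HasCompactSupport (f n)) ∧
      Tendsto (fun n => smear U (f n) ψ) atTop (𝓝 ψ) := by
  let φ : ℕ → ContDiffBump (0 : ℝ) := fun n =>
    ⟨1 / ((n : ℝ) + 1) / 2, 1 / ((n : ℝ) + 1), by positivity, half_lt_self (by positivity)⟩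
  have hφ : Tendsto (fun n => (φ n).rOut) atTop (𝓝 0) := tendsto_one_div_add_atTop_nhds_zero_nat
  have hlim := ContDiffBump.convolution_tendsto_right_of_continuous (μ := volume) hφ
    (hU.continuous ψ) 0
  simp only [← smear_eq_convolution, hU.map_zero, one_apply_eq_self] at hlim
  exact ⟨fun n => (φ n).normed volume, fun n => (φ n).contDiff_normed,
    fun n => (φ n).hasCompactSupport_normed, hlim⟩

theorem IsStrongTimeOperator.dense_ccrSubmodule (hT : IsStrongTimeOperator A T)
    (hcl : T.IsClosed) : Dense (ccrSubmodule A T : Set E) := by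
  obtain ⟨-, hs, U, hU, hUT⟩ := isStrongTimeOperator_iff.mp hT
  refine dense_closure.mp (hs.1.mono fun ψ hψ => ?_)
  obtain ⟨f, hf, hfs, hlim⟩ := hU.exists_tendsto_smear ψ
  exact mem_closure_of_tendsto hlim
    (.of_forall fun n => hU.smear_mem_ccrSubmodule hcl hUT (hf n) (hfs n) hψ)

theorem IsStrongTimeOperator.exists_dense_isCCRDomain [Nontrivial E]
    (hT : IsStrongTimeOperator A T) (hcl : T.IsClosed) :
    ∃ D : Submodule ℂ E, IsCCRDomain A T D ∧ Dense (D : Set E) := by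
  have hd := hT.dense_ccrSubmodule hcl
  refine ⟨ccrSubmodule A T, isCCRDomain_ccrSubmodule ?_, hd⟩
  rintro h
  rw [h, Submodule.bot_coe, dense_iff_closure_eq, closure_singleton] at hd
  exact Set.singleton_ne_univ 0 hd

end StrongTimeOperators

section Partition

theorem exists_injective_forall_ne {ι : Type*} [Countable ι] (r : ι → ℕ) :
    ∃ g : ι → ℕ, Function.Injective g ∧ ∀ p, g p ≠ r p := by
  obtain ⟨c, hc⟩ := Countable.exists_injective_nat ι
  refine ⟨fun p => if 2 * c p = r p then 2 * c p + 1 else 2 * c p, fun p q hpq => hc ?_,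
    fun p => ?_⟩
  · dsimp only at hpq
    split_ifs at hpq <;> omega
  · dsimp only
    split_ifs <;> omega

theorem exists_partition_injOn {ι κ : Type*} [Countable ι] (π : ι → κ) {σ : ℕ → ι}
    (hσ : Function.Injective (π ∘ σ)) :
    ∃ J : ι → ℕ, (∀ j, Infinite {p // J p = j}) ∧ (∀ p q, J p = J q → π p = π q → p = q) ∧
      ∀ j, {p | J p = j ∧ p ∉ Set.range σ}.Subsingleton := by
  classical
  -- `σ` is distributed evenly over all classes; every other `p` gets a class of its own that avoids
  -- the one containing the `σ i` with `π (σ i) = π p`.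
  let r : κ → ℕ := fun a => (Nat.unpair (Function.invFun (π ∘ σ) a)).1
  obtain ⟨g, hg, hgr⟩ := exists_injective_forall_ne (r ∘ π)
  let J : ι → ℕ := fun p => if p ∈ Set.range σ then r (π p) else g p
  have hJσ : ∀ i, J (σ i) = (Nat.unpair i).1 := fun i => by
    simp only [J, Set.mem_range_self, if_true, r]
    rw [← Function.comp_apply (f := π), Function.leftInverse_invFun hσ i]
  have hJg : ∀ {p}, p ∉ Set.range σ → J p = g p := fun h => if_neg h
  refine ⟨J, fun j => ?_, fun p q hJ hπ => ?_, fun j p hp q hq => hg ?_⟩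
  · refine .of_injective (fun l : ℕ => (⟨σ (Nat.pair j l), by simp [hJσ]⟩ : {p // J p = j}))
      fun l l' h => ?_
    simpa using hσ.of_comp (Subtype.ext_iff.mp h)
  · simp only [J] at hJ
    split_ifs at hJ with hp hq hq
    · obtain ⟨i, rfl⟩ := hp
      obtain ⟨i', rfl⟩ := hq
      exact congrArg σ (hσ hπ)
    · exact absurd (hJ.symm.trans (congrArg r hπ)) (hgr q)
    · exact absurd (hJ.trans (congrArg r hπ.symm)) (hgr p)
    · exact hg hJ
  · rw [← hJg hp.2, ← hJg hq.2, hp.1, hq.1]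

open Filter Topology

theorem exists_strictMono_summable_sq {e : ℕ → ℝ} (he : Tendsto e atTop (𝓝 0)) :
    ∃ k : ℕ → ℕ, StrictMono k ∧ Summable fun i => e (k i) ^ 2 := by
  have hsq : Tendsto (fun n => e n ^ 2) atTop (𝓝 0) := by simpa using he.pow 2
  obtain ⟨k, hk, hke⟩ := extraction_forall_of_eventually
    fun i => hsq.eventually_le_const (by positivity : (0 : ℝ) < (1 / 2) ^ i)
  exact ⟨k, hk, .of_nonneg_of_le (fun _ => sq_nonneg _) hke summable_geometric_two⟩

theorem exists_partition_summable_sq {ι : Type*} [Countable ι] {π : ι → ℕ}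
    (hπ : Function.Surjective π) {e : ℕ → ℝ} (he : Tendsto e atTop (𝓝 0)) :
    ∃ J : ι → ℕ, (∀ j, Infinite {p // J p = j}) ∧ (∀ p q, J p = J q → π p = π q → p = q) ∧
      ∀ j, Summable fun p : {p // J p = j} => e (π p) ^ 2 := by
  obtain ⟨k, hk, hke⟩ := exists_strictMono_summable_sq he
  obtain ⟨s, hs⟩ := hπ.hasRightInverse
  have hπσ : ∀ i, π (s (k i)) = k i := fun i => hs (k i)
  have hσ : Function.Injective (π ∘ s ∘ k) := fun i i' h => hk.injective (by simpa [hπσ] using h)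
  obtain ⟨J, hinf, hinj, hsub⟩ := exists_partition_injOn π hσ
  refine ⟨J, hinf, hinj, fun j => ?_⟩
  let f : ι → ℝ := (Set.range (s ∘ k)).indicator fun p => e (π p) ^ 2
  have hf : Summable f := by
    rw [← hσ.of_comp.summable_iff fun x hx => Set.indicator_of_notMem hx _]
    simpa [f, Function.comp_def, hπσ] using hke
  refine (hf.subtype {p | J p = j}).congr_cofinite (Set.Finite.subset (Set.Subsingleton.finite
    ((hsub j).preimage Subtype.val_injective)) fun p hp => ⟨p.2, fun hpσ => hp ?_⟩)
  exact Set.indicator_of_mem hpσ fun p => e (π p) ^ 2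

end Partition

section EigenDecomposition

theorem exists_orthonormal_span_range_eq_iSup {𝕜 E κ : Type*} [RCLike 𝕜] [NormedAddCommGroup E]
    [InnerProductSpace 𝕜 E] {V : κ → Submodule 𝕜 E} [∀ n, FiniteDimensional 𝕜 (V n)]
    (hV : OrthogonalFamily 𝕜 (fun n => V n) fun n => (V n).subtypeₗᵢ) :
    ∃ v : (Σ n, Fin (Module.finrank 𝕜 (V n))) → E, Orthonormal 𝕜 v ∧ (∀ p, v p ∈ V p.1) ∧
      Submodule.span 𝕜 (Set.range v) = ⨆ n, V n := by
  let b := fun n => stdOrthonormalBasis 𝕜 (V n)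
  refine ⟨fun p => b p.1 p.2, hV.orthonormal_sigma_orthonormal fun n => (b n).orthonormal,
    fun p => (b p.1 p.2).2, ?_⟩
  have hspan : ∀ n, Submodule.span 𝕜 (Set.range fun i => (b n i : E)) = V n := by
    intro n
    have h := congrArg (Submodule.map (V n).subtype) (b n).toBasis.span_eq
    rw [Submodule.map_span, ← Set.range_comp, Submodule.map_top, Submodule.range_subtype] at h
    simpa [Function.comp_def] using h
  rw [Set.range_sigma_eq_iUnion_range, Submodule.span_iUnion]
  exact iSup_congr hspan

variable {E : Type*} [NormedAddCommGroup E] [InnerProductSpace ℂ E] {A : E →ₗ.[ℂ] E}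

theorem iSup_eigenspace_eq_of_pointSpectrum_eq_range {κ : Type*} {e : κ → ℂ}
    (h : pointSpectrum A = Set.range e) : ⨆ z, eigenspace A z = ⨆ n, eigenspace A (e n) := by
  refine le_antisymm (iSup_le fun z => ?_) (iSup_le fun n => le_iSup (eigenspace A) (e n))
  by_cases hz : z ∈ pointSpectrum A
  · obtain ⟨n, rfl⟩ := h ▸ hz
    exact le_iSup (fun n => eigenspace A (e n)) n
  · rw [not_ne_iff.mp hz]
    exact bot_le

theorem orthogonalFamily_eigenspace {κ : Type*} (hA : A.IsFormalAdjoint A) {e : κ → ℂ}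
    (he : Function.Injective e) :
    OrthogonalFamily ℂ (fun n => eigenspace A (e n)) fun n => (eigenspace A (e n)).subtypeₗᵢ :=
  .of_pairwise fun _ _ h => eigenspace_isOrtho_eigenspace hA (he.ne h)

theorem exists_prod_equiv_of_infinite_fibers {ι : Type*} [Countable ι] {J : ι → ℕ}
    (hJ : ∀ j, Infinite {p // J p = j}) :
    ∃ m : {j : ℕ // (j : ℕ∞) < ⊤} × ℕ ≃ ι, ∀ q, J (m q) = q.1 := by
  let ε : ∀ j, ℕ ≃ {p // J p = j} := fun j => Classical.choice nonempty_equiv_of_countable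
  refine ⟨((Equiv.subtypeUnivEquiv ENat.natCast_lt_top).prodCongr (.refl ℕ)).trans
    ((Equiv.sigmaEquivProd ℕ ℕ).symm.trans
      ((Equiv.sigmaCongrRight ε).trans (Equiv.sigmaFiberEquiv J))), fun q => (ε q.1 q.2).2⟩

open Filter Topology in
theorem nonempty_eigenDecomposition (hA : A.IsFormalAdjoint A) {e : ℕ → ℝ}
    (hp : pointSpectrum A = Set.range fun n => (e n : ℂ)) (hinj : Function.Injective e)
    (he : Tendsto e atTop (𝓝 0)) (hfin : ∀ n, FiniteDimensional ℂ (eigenspace A (e n))) :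
    Nonempty (EigenDecomposition A) := by
  obtain ⟨v, hv, hmem, hspan⟩ := exists_orthonormal_span_range_eq_iSup
    (orthogonalFamily_eigenspace hA (e := fun n => (e n : ℂ)) (Complex.ofReal_injective.comp hinj))
  have hsurj : Function.Surjective
      (Sigma.fst : (Σ n, Fin (Module.finrank ℂ (eigenspace A (e n)))) → ℕ) := by
    intro n
    have hn : eigenspace A (e n) ≠ ⊥ := show (e n : ℂ) ∈ pointSpectrum A from hp ▸ ⟨n, rfl⟩
    exact ⟨⟨n, 0, Module.finrank_pos_iff.mpr (Submodule.nontrivial_iff_ne_bot.mpr hn)⟩, rfl⟩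
  obtain ⟨J, hJ, hJinj, hJsum⟩ := exists_partition_summable_sq hsurj he
  obtain ⟨m, hm⟩ := exists_prod_equiv_of_infinite_fibers hJ
  have hclass : ∀ j : {j : ℕ // (j : ℕ∞) < ⊤},
      Function.Injective fun n => (⟨m (j, n), hm (j, n)⟩ : {p // J p = j}) :=
    fun j n n' h => congrArg Prod.snd (m.injective (Subtype.ext_iff.mp h))
  have hspan' : (Submodule.span ℂ (Set.range (v ∘ m))).topologicalClosure = ppSubspace A := by
    rw [m.surjective.range_comp, hspan, ppSubspace, iSup_eigenspace_eq_of_pointSpectrum_eq_range hp]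
  have hsum : ∀ j, Summable fun n => e (m (j, n)).1 ^ 2 := fun j => by
    simpa only [Function.comp_def] using (hJsum j).comp_injective (hclass j)
  exact ⟨{
    N := ⊤
    vec := fun j n => v (m (j, n))
    val := fun j n => e (m (j, n)).1
    orthonormal := hv.comp m m.injective
    eigen := fun j n => hmem _
    injective := fun j n n' h => hclass j <| Subtype.ext <|
      hJinj _ _ ((hm (j, n)).trans (hm (j, n')).symm) (hinj h)
    summable := hsum
    span_eq := hspan' }⟩

end EigenDecomposition

section MatrixForm

variable {ι κ : Type*}

/-- The diagonal operator with entries `w` on coefficient vectors. -/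
def diag (w : ι → ℂ) : (ι →₀ ℂ) →ₗ[ℂ] ι →₀ ℂ :=
  Finsupp.linearCombination ℂ fun p => .single p (w p)

theorem diag_single (w : ι → ℂ) (p : ι) (a : ℂ) : diag w (.single p a) = .single p (a * w p) := by
  simp [diag]

theorem linearCombination_diag {E : Type*} [AddCommMonoid E] [Module ℂ E] (v : ι → E) (w : ι → ℂ)
    (c : ι →₀ ℂ) :
    Finsupp.linearCombination ℂ v (diag w c) =
      Finsupp.linearCombination ℂ (fun p => w p • v p) c := by
  simp [diag, Finsupp.linearCombination_linearCombination]

theorem diag_diag (w w' : ι → ℂ) (c : ι →₀ ℂ) :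
    diag w (diag w' c) = diag (fun p => w' p * w p) c := by
  rw [diag, linearCombination_diag, diag]
  simp

theorem diag_one (c : ι →₀ ℂ) : diag 1 c = c := by
  induction c using Finsupp.induction_linear with
  | zero => rw [map_zero]
  | add c c' h h' => rw [map_add, h, h']
  | single p a => simp [diag_single]

/-- The sesquilinear form with matrix `m` on coefficient vectors. -/
def matrixForm (m : ι → ι → ℂ) : (ι →₀ ℂ) →ₗ⋆[ℂ] (ι →₀ ℂ) →ₗ[ℂ] ℂ :=
  LinearMap.mk₂'ₛₗ (starRingEnd ℂ) (RingHom.id ℂ)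
    (fun c c' => c.sum fun p a => conj a * Finsupp.linearCombination ℂ (m p) c')
    (fun c₁ c₂ c' => Finsupp.sum_add_index' (by simp) (by simp [add_mul]))
    (fun a c c' => by
      rw [Finsupp.sum_smul_index (by simp), Finsupp.smul_sum]
      simp [mul_assoc])
    (fun c c₁ c₂ => by simp [mul_add])
    (fun a c c' => by
      rw [Finsupp.smul_sum]
      simp [mul_left_comm])

theorem matrixForm_apply (m : ι → ι → ℂ) (c c' : ι →₀ ℂ) :
    matrixForm m c c' = c.sum fun p a => conj a * Finsupp.linearCombination ℂ (m p) c' := rfl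

theorem matrixForm_single_single (m : ι → ι → ℂ) (p q : ι) (a b : ℂ) :
    matrixForm m (.single p a) (.single q b) = conj a * b * m p q := by
  simp [matrixForm_apply, mul_assoc]

theorem eq_matrixForm {f : (ι →₀ ℂ) → (ι →₀ ℂ) → ℂ} {m : ι → ι → ℂ}
    (add_left : ∀ c₁ c₂ c', f (c₁ + c₂) c' = f c₁ c' + f c₂ c')
    (add_right : ∀ c c₁ c₂, f c (c₁ + c₂) = f c c₁ + f c c₂)
    (single : ∀ p q a b, f (.single p a) (.single q b) = conj a * b * m p q) (c c' : ι →₀ ℂ) :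
    f c c' = matrixForm m c c' := by
  have zero_left : ∀ c', f 0 c' = 0 := fun c' => by simpa using add_left 0 0 c'
  have zero_right : ∀ c, f c 0 = 0 := fun c => by simpa using add_right c 0 0
  induction c using Finsupp.induction_linear with
  | zero => rw [zero_left, map_zero, LinearMap.zero_apply]
  | add c₁ c₂ h₁ h₂ => rw [add_left, h₁, h₂, map_add, LinearMap.add_apply]
  | single p a =>
    induction c' using Finsupp.induction_linear with
    | zero => rw [zero_right, map_zero]
    | add c₁ c₂ h₁ h₂ => rw [add_right, h₁, h₂, map_add]
    | single q b => rw [single, matrixForm_single_single]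

theorem conj_matrixForm (m : ι → ι → ℂ) (c c' : ι →₀ ℂ) :
    conj (matrixForm m c c') = matrixForm (fun p q => conj (m q p)) c' c :=
  eq_matrixForm (f := fun c' c => conj (matrixForm m c c')) (by simp) (by simp)
    (by simp [matrixForm_single_single, mul_comm]) c' c

theorem matrixForm_diag_left (m : ι → ι → ℂ) (w : ι → ℂ) (c c' : ι →₀ ℂ) :
    matrixForm m (diag w c) c' = matrixForm (fun p q => conj (w p) * m p q) c c' :=
  eq_matrixForm (f := fun c c' => matrixForm m (diag w c) c') (by simp) (by simp)
    (fun p q a b => by simp only [diag_single, matrixForm_single_single, map_mul]; ring) c c'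

theorem matrixForm_diag_right (m : ι → ι → ℂ) (w : ι → ℂ) (c c' : ι →₀ ℂ) :
    matrixForm m c (diag w c') = matrixForm (fun p q => w q * m p q) c c' :=
  eq_matrixForm (f := fun c c' => matrixForm m c (diag w c')) (by simp) (by simp)
    (fun p q a b => by simp only [diag_single, matrixForm_single_single]; ring) c c'

theorem matrixForm_add (m m' : ι → ι → ℂ) (c c' : ι →₀ ℂ) :
    matrixForm (fun p q => m p q + m' p q) c c' = matrixForm m c c' + matrixForm m' c c' :=
  (eq_matrixForm (f := fun c c' => matrixForm m c c' + matrixForm m' c c')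
    (fun _ _ _ => by simp only [map_add, LinearMap.add_apply]; ring)
    (fun _ _ _ => by simp only [map_add]; ring)
    (fun p q a b => by simp only [matrixForm_single_single]; ring) c c').symm

theorem matrixForm_const_mul (k : ℂ) (m : ι → ι → ℂ) (c c' : ι →₀ ℂ) :
    matrixForm (fun p q => k * m p q) c c' = k * matrixForm m c c' :=
  (eq_matrixForm (f := fun c c' => k * matrixForm m c c') (by simp [mul_add]) (by simp [mul_add])
    (fun p q a b => by simp only [matrixForm_single_single]; ring) c c').symm

/-- The coefficient vectors whose sum over each class of `J` vanishes. -/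
def zeroSum (J : ι → κ) : Submodule ℂ (ι →₀ ℂ) := LinearMap.ker (Finsupp.lmapDomain ℂ ℂ J)

theorem matrixForm_eq_zero_of_mem_zeroSum {J : ι → κ} (g : ι → κ → ℂ) (c : ι →₀ ℂ) {c' : ι →₀ ℂ}
    (hc' : c' ∈ zeroSum J) : matrixForm (fun p q => g p (J q)) c c' = 0 := by
  have h : ∀ p, Finsupp.linearCombination ℂ (fun q => g p (J q)) c' = 0 := fun p => by
    have := Finsupp.linearCombination_mapDomain ℂ (v' := g p) J c'
    rw [show Finsupp.mapDomain J c' = 0 from hc', map_zero] at this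
    exact this.symm
  simp [matrixForm_apply, h]

theorem matrixForm_add_eq_zero_of_mem_zeroSum [DecidableEq κ] {J : ι → κ} (u : ι → ℂ)
    {c c' : ι →₀ ℂ} (hc : c ∈ zeroSum J) (hc' : c' ∈ zeroSum J) :
    matrixForm (fun p q => if J p = J q then u p + u q else 0) c c' = 0 := by
  have hleft : matrixForm (fun p q => if J p = J q then u p else 0) c c' = 0 :=
    matrixForm_eq_zero_of_mem_zeroSum (fun p k => if J p = k then u p else 0) c hc'
  have hright : matrixForm (fun p q => if J p = J q then u q else 0) c c' = 0 := by
    rw [← map_eq_zero (starRingEnd ℂ), conj_matrixForm]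
    exact matrixForm_eq_zero_of_mem_zeroSum (fun q k => conj (if k = J q then u q else 0)) c' hc
  have hadd := matrixForm_add (fun p q => if J p = J q then u p else 0)
    (fun p q => if J p = J q then u q else 0) c c'
  rw [hleft, hright, add_zero] at hadd
  simpa only [ite_add_ite, add_zero] using hadd

end MatrixForm

section PointForm

theorem norm_inv_inv_sub_inv_le {𝕜 : Type*} [NormedField 𝕜] {a b : 𝕜} (hb : b ≠ 0)
    (hab : ‖b‖ ≤ ‖a‖ / 2) : ‖(b⁻¹ - a⁻¹)⁻¹‖ ≤ 2 * ‖b‖ := by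
  have : 0 < ‖b‖ := norm_pos_iff.mpr hb
  have ha : ‖a‖⁻¹ ≤ ‖b‖⁻¹ / 2 := by
    rw [div_eq_mul_inv, ← mul_inv]
    exact inv_anti₀ (by positivity) (by linarith)
  have hsub : (2 * ‖b‖)⁻¹ ≤ ‖b⁻¹ - a⁻¹‖ := calc
    (2 * ‖b‖)⁻¹ = ‖b‖⁻¹ - ‖b‖⁻¹ / 2 := by rw [mul_inv]; ring
    _ ≤ ‖b⁻¹‖ - ‖a⁻¹‖ := by rw [norm_inv, norm_inv]; linarith
    _ ≤ ‖b⁻¹ - a⁻¹‖ := norm_sub_norm_le _ _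
  rw [norm_inv]
  exact inv_le_of_inv_le₀ (by positivity) hsub

variable {E : Type*} [NormedAddCommGroup E] [InnerProductSpace ℂ E] {H : E →ₗ.[ℂ] E}

theorem value_inverse_of_mem_graph (hk : LinearMap.ker H.toFun = ⊥) {x y : E}
    (h : (x, y) ∈ H.graph) : value H.inverse y = x :=
  value_eq_of_mem_graph (by rw [LinearPMap.inverse_graph hk]; exact ⟨(x, y), h, rfl⟩)

theorem eq_of_mem_graph_of_ker_eq_bot (hk : LinearMap.ker H.toFun = ⊥) {x x' y : E}
    (h : (x, y) ∈ H.graph) (h' : (x', y) ∈ H.graph) : x = x' := by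
  rw [← value_inverse_of_mem_graph hk h, value_inverse_of_mem_graph hk h']

namespace EigenDecomposition

variable (d : EigenDecomposition H)

/-- The eigenvectors `e_n^j`, as a single family indexed by the pairs `(j, n)`. -/
def bvec (p : d.Idx × ℕ) : E := d.vec p.1 p.2

/-- The eigenvalues `F_{jn}`, as a single complex family indexed by the pairs `(j, n)`. -/
def bval (p : d.Idx × ℕ) : ℂ := d.val p.1 p.2

/-- The vector of `D_p` with given coefficients in the basis `e_n^j`. -/
def vecSum : (d.Idx × ℕ →₀ ℂ) →ₗ[ℂ] E := Finsupp.linearCombination ℂ d.bvec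

theorem orthonormal_bvec : Orthonormal ℂ d.bvec := d.orthonormal

theorem conj_bval (p : d.Idx × ℕ) : conj (d.bval p) = d.bval p := Complex.conj_ofReal _

theorem bvec_mem_graph (p : d.Idx × ℕ) : (d.bvec p, d.bval p • d.bvec p) ∈ H.graph :=
  mem_eigenspace_iff.mp (d.eigen p.1 p.2)

theorem bval_ne_zero (hk : LinearMap.ker H.toFun = ⊥) (p : d.Idx × ℕ) : d.bval p ≠ 0 := by
  intro h
  have hp := d.bvec_mem_graph p
  rw [h, zero_smul] at hp
  exact d.orthonormal_bvec.ne_zero p (eq_of_mem_graph_of_ker_eq_bot hk hp H.graph.zero_mem)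

theorem bval_injOn {p q : d.Idx × ℕ} (hpq : p.1 = q.1) (h : d.bval p = d.bval q) : p = q := by
  obtain ⟨j, n⟩ := p
  obtain ⟨k, m⟩ := q
  obtain rfl : j = k := hpq
  exact congrArg (Prod.mk j) (d.injective j (Complex.ofReal_injective h))

open Filter Topology in
theorem tendsto_bval (j : d.Idx) : Tendsto (fun n => d.bval (j, n)) atTop (𝓝 0) := by
  have h := (d.summable j).tendsto_atTop_zero.sqrt
  simp only [Real.sqrt_sq_eq_abs, Real.sqrt_zero] at h
  rw [tendsto_zero_iff_norm_tendsto_zero]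
  simpa only [bval, Complex.norm_real, Real.norm_eq_abs] using h

theorem vecSum_single (p : d.Idx × ℕ) (a : ℂ) : d.vecSum (.single p a) = a • d.bvec p :=
  Finsupp.linearCombination_single ℂ a p

theorem vecSum_mem_graph (c : d.Idx × ℕ →₀ ℂ) :
    (d.vecSum c, d.vecSum (diag d.bval c)) ∈ H.graph := by
  induction c using Finsupp.induction_linear with
  | zero => simp
  | add c c' h h' =>
    simp only [map_add]
    exact H.graph.add_mem h h'
  | single p a =>
    rw [diag_single, vecSum_single, vecSum_single, mul_smul]
    exact H.graph.smul_mem a (d.bvec_mem_graph p)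

theorem diag_bval_diag_one_div_bval (hk : LinearMap.ker H.toFun = ⊥) (c : d.Idx × ℕ →₀ ℂ) :
    diag d.bval (diag (fun p => 1 / d.bval p) c) = c := by
  simp only [diag_diag, one_div_mul_cancel (d.bval_ne_zero hk _)]
  exact diag_one c

theorem invSq_vecSum (hk : LinearMap.ker H.toFun = ⊥) (c : d.Idx × ℕ →₀ ℂ) :
    invSq H (d.vecSum c) = d.vecSum (diag (fun p => (1 / d.bval p) ^ 2) c) := by
  have hinv : ∀ c, value H.inverse (d.vecSum c) = d.vecSum (diag (fun p => 1 / d.bval p) c) := by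
    intro c
    refine value_inverse_of_mem_graph hk ?_
    simpa only [d.diag_bval_diag_one_div_bval hk] using
      d.vecSum_mem_graph (diag (fun p => 1 / d.bval p) c)
  rw [invSq, hinv, hinv, diag_diag]
  simp only [sq]

theorem inner_vecSum_vecSum (c c' : d.Idx × ℕ →₀ ℂ) :
    inner ℂ (d.vecSum c) (d.vecSum c') = matrixForm (fun p q => if p = q then 1 else 0) c c' :=
  eq_matrixForm (f := fun c c' => inner ℂ (d.vecSum c) (d.vecSum c'))
    (by simp) (by simp)
    (fun p q a b => by
      simp only [vecSum_single, inner_smul_left, inner_smul_right,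
        orthonormal_iff_ite.mp d.orthonormal_bvec]
      ring) c c'

theorem domP_eq_range_vecSum : d.domP = LinearMap.range d.vecSum := by
  rw [vecSum, Finsupp.range_linearCombination]
  apply le_antisymm
  · refine iSup_le fun j => Submodule.span_mono ?_
    rintro _ ⟨n, rfl⟩
    exact ⟨(j, n), rfl⟩
  · rw [Submodule.span_le]
    rintro _ ⟨p, rfl⟩
    exact Submodule.mem_iSup_of_mem p.1 (Submodule.subset_span ⟨p.2, rfl⟩)

theorem vecSum_mem_domP (c : d.Idx × ℕ →₀ ℂ) : d.vecSum c ∈ d.domP :=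
  d.domP_eq_range_vecSum ▸ LinearMap.mem_range_self _ c

theorem exists_vecSum_of_mem_domP {φ : E} (hφ : φ ∈ d.domP) : ∃ c, d.vecSum c = φ :=
  LinearMap.mem_range.mp (d.domP_eq_range_vecSum ▸ hφ)

theorem domP_le_ppSubspace : d.domP ≤ ppSubspace H :=
  le_trans (iSup_le fun _ => Submodule.span_le.mpr <| Set.range_subset_iff.mpr fun n =>
    Submodule.mem_iSup_of_mem _ (d.eigen _ n)) (Submodule.le_topologicalClosure _)

theorem bvec_mem_orthogonal_space {j : d.Idx} {p : d.Idx × ℕ} (h : p.1 ≠ j) :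
    d.bvec p ∈ (d.space j)ᗮ := by
  rw [space, Submodule.orthogonal_closure, domS]
  refine Submodule.isOrtho_span.mpr ?_ |>.symm (Submodule.subset_span (Set.mem_singleton _))
  rintro _ ⟨n, rfl⟩ _ rfl
  exact d.orthonormal_bvec.2 (i := (j, n)) fun hp => h (congrArg Prod.fst hp).symm

theorem starProjection_vecSum [CompleteSpace E] (j : d.Idx) (c : d.Idx × ℕ →₀ ℂ) :
    (d.space j).starProjection (d.vecSum c) =
      d.vecSum (diag (fun p => if p.1 = j then 1 else 0) c) := by
  have hbvec : ∀ p, (d.space j).starProjection (d.bvec p) = if p.1 = j then d.bvec p else 0 := by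
    intro p
    split_ifs with h
    · subst h
      exact Submodule.starProjection_eq_self_iff.mpr
        (Submodule.le_topologicalClosure _ (Submodule.subset_span ⟨p.2, rfl⟩))
    · exact (Submodule.starProjection_apply_eq_zero_iff _).mpr (d.bvec_mem_orthogonal_space h)
  induction c using Finsupp.induction_linear with
  | zero => simp
  | add c c' h h' => simp only [map_add, h, h']
  | single p a =>
    rw [diag_single, vecSum_single, vecSum_single, map_smul, hbvec]
    split_ifs <;> simp

/-- The matrix of `⨁_j S_j` in the basis `e_n^j`; its diagonal vanishes because `x / 0 = 0`. -/
def opEntry (p q : d.Idx × ℕ) : ℂ :=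
  if p.1 = q.1 then Complex.I / (1 / d.bval p - 1 / d.bval q) else 0

theorem conj_opEntry (p q : d.Idx × ℕ) : conj (d.opEntry p q) = d.opEntry q p := by
  unfold opEntry
  by_cases h : p.1 = q.1
  · rw [if_pos h, if_pos h.symm, ← neg_sub (1 / d.bval p), div_neg, ← neg_div]
    simp only [map_div₀, map_sub, map_one, conj_bval, Complex.conj_I]
  · rw [if_neg h, if_neg (Ne.symm h), map_zero]

open Filter in
theorem summable_norm_opEntry_sq (hk : LinearMap.ker H.toFun = ⊥) (j : d.Idx) (p : d.Idx × ℕ) :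
    Summable fun n => ‖d.opEntry (j, n) p‖ ^ 2 := by
  have hsmall : ∀ᶠ n in atTop, ‖d.bval (j, n)‖ < ‖d.bval p‖ / 2 :=
    (tendsto_zero_iff_norm_tendsto_zero.mp (d.tendsto_bval j)).eventually_lt_const
      (half_pos (norm_pos_iff.mpr (d.bval_ne_zero hk p)))
  refine Summable.of_norm_bounded_eventually_nat ((d.summable j).mul_left 4) ?_
  filter_upwards [hsmall] with n hn
  have hle : ‖d.opEntry (j, n) p‖ ≤ 2 * |d.val j n| := by
    unfold opEntry
    split_ifs
    · rw [norm_div, Complex.norm_I, one_div, ← norm_inv, one_div, one_div, ← Real.norm_eq_abs,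
        ← Complex.norm_real]
      exact norm_inv_inv_sub_inv_le (d.bval_ne_zero hk (j, n)) hn.le
    · rw [norm_zero]
      positivity
  calc ‖‖d.opEntry (j, n) p‖ ^ 2‖ = ‖d.opEntry (j, n) p‖ ^ 2 := by rw [norm_pow, norm_norm]
    _ ≤ (2 * |d.val j n|) ^ 2 := by gcongr
    _ = 4 * d.val j n ^ 2 := by rw [mul_pow, sq_abs]; norm_num

theorem summable_opEntry_smul_vec [CompleteSpace E] (hk : LinearMap.ker H.toFun = ⊥) (j : d.Idx)
    (c : d.Idx × ℕ →₀ ℂ) :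
    Summable fun n => Finsupp.linearCombination ℂ (d.opEntry (j, n)) c • d.vec j n := by
  induction c using Finsupp.induction_linear with
  | zero => simp
  | add c c' h h' => simpa only [map_add, add_smul] using h.add h'
  | single p a =>
    have hortho : Orthonormal ℂ (d.vec j) :=
      d.orthonormal.comp (fun n => (j, n)) (Prod.mk_right_injective j)
    simp only [Finsupp.linearCombination_single, smul_assoc]
    exact ((hortho.orthogonalFamily.summable_iff_norm_sq_summable _).mpr
      (d.summable_norm_opEntry_sq hk j p)).const_smul a

theorem I_smul_tsum_inner_div_eq (j : d.Idx) (n : ℕ) (c : d.Idx × ℕ →₀ ℂ) :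
    Complex.I • ∑' m, (if m = n then 0 else
      inner ℂ (d.vec j m) (d.vecSum c) / (1 / (d.val j n : ℂ) - 1 / (d.val j m : ℂ))) =
    Finsupp.linearCombination ℂ (d.opEntry (j, n)) c := by
  have hterm : ∀ m, Complex.I • (if m = n then 0 else
      inner ℂ (d.vec j m) (d.vecSum c) / (1 / (d.val j n : ℂ) - 1 / (d.val j m : ℂ))) =
      c (j, m) * d.opEntry (j, n) (j, m) := by
    intro m
    rw [show inner ℂ (d.vec j m) (d.vecSum c) = c (j, m) from
      d.orthonormal_bvec.inner_right_finsupp c (j, m)]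
    split_ifs with h
    · simp [opEntry, h]
    · simp only [opEntry, if_true, smul_eq_mul]
      exact mul_div_left_comm _ _ _
  have hsupp : (Function.support fun p => c p * d.opEntry (j, n) p) ⊆
      Set.range fun m => (j, m) := by
    rintro ⟨k, m⟩ hm
    have : j = k := by_contra fun h => hm (by simp [opEntry, h])
    exact ⟨m, by rw [this]⟩
  rw [← tsum_const_smul'']
  simp only [hterm]
  rw [(Prod.mk_right_injective j).tsum_eq hsupp, Finsupp.linearCombination_apply, Finsupp.sum]
  exact tsum_eq_sum fun p hp => by rw [Finsupp.notMem_support_iff.mp hp, zero_mul]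

theorem opS_vecSum (j : d.Idx) (c : d.Idx × ℕ →₀ ℂ) :
    d.opS j (d.vecSum c) =
      ∑' n, Finsupp.linearCombination ℂ (d.opEntry (j, n)) c • d.vec j n := by
  rw [opS, ← tsum_const_smul'']
  simp only [← smul_assoc, I_smul_tsum_inner_div_eq]

theorem inner_bvec_opS [CompleteSpace E] (hk : LinearMap.ker H.toFun = ⊥) (j : d.Idx)
    (p : d.Idx × ℕ) (c : d.Idx × ℕ →₀ ℂ) :
    inner ℂ (d.bvec p) (d.opS j (d.vecSum c)) =
      Finsupp.linearCombination ℂ (fun q => if p.1 = j then d.opEntry p q else 0) c := by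
  have hsum := (d.summable_opEntry_smul_vec hk j c).hasSum.mapL (innerSL ℂ (d.bvec p))
  rw [← opS_vecSum] at hsum
  simp only [innerSL_apply_apply, inner_smul_right,
    show ∀ n, d.vec j n = d.bvec (j, n) from fun _ => rfl,
    orthonormal_iff_ite.mp d.orthonormal_bvec] at hsum
  refine hsum.unique ?_
  obtain ⟨k, m⟩ := p
  by_cases h : k = j
  · subst h
    have h := hasSum_single (f := fun n => Finsupp.linearCombination ℂ (d.opEntry (k, n)) c *
      if (k, m) = (k, n) then 1 else 0) m fun n hn => by simp [hn.symm]
    simpa using h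
  · simp [h, Finsupp.linearCombination_apply, hasSum_zero]

/-- The matrix of the form `t_p` in the basis `e_n^j`. -/
def coeff (p q : d.Idx × ℕ) : ℂ :=
  -(1 / 2) * ((1 / d.bval p) ^ 2 + (1 / d.bval q) ^ 2) * d.opEntry p q

theorem conj_coeff (p q : d.Idx × ℕ) : conj (d.coeff p q) = d.coeff q p := by
  simp only [coeff, map_mul, map_neg, map_add, map_pow, map_div₀, map_one, map_ofNat, conj_bval,
    conj_opEntry, add_comm]

theorem coeff_of_ne {p q : d.Idx × ℕ} (h : p.1 ≠ q.1) : d.coeff p q = 0 := by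
  rw [coeff, opEntry, if_neg h, mul_zero]

theorem inner_vecSum_opS [CompleteSpace E] (hk : LinearMap.ker H.toFun = ⊥) (j : d.Idx)
    (c c' : d.Idx × ℕ →₀ ℂ) :
    inner ℂ (d.vecSum c) (d.opS j (d.vecSum c')) =
      matrixForm (fun p q => if p.1 = j then d.opEntry p q else 0) c c' := by
  rw [matrixForm_apply, vecSum, Finsupp.linearCombination_apply, Finsupp.sum_inner]
  exact Finsupp.sum_congr fun p _ => by
    rw [inner_smul_left, ← d.inner_bvec_opS hk j p c', vecSum]

theorem inner_opS_vecSum [CompleteSpace E] (hk : LinearMap.ker H.toFun = ⊥) (j : d.Idx)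
    (c c' : d.Idx × ℕ →₀ ℂ) :
    inner ℂ (d.opS j (d.vecSum c)) (d.vecSum c') =
      matrixForm (fun p q => if p.1 = j then d.opEntry p q else 0) c c' := by
  rw [← inner_conj_symm, inner_vecSum_opS d hk, conj_matrixForm]
  congr 3
  funext p q
  rw [apply_ite conj, conj_opEntry, map_zero]
  by_cases h : p.1 = q.1
  · rw [h]
  · simp [opEntry, h]

theorem formJ_vecSum [CompleteSpace E] (hk : LinearMap.ker H.toFun = ⊥) (j : d.Idx)
    (c c' : d.Idx × ℕ →₀ ℂ) :
    d.formJ j (d.vecSum c) (d.vecSum c') =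
      matrixForm (fun p q => if p.1 = j then d.coeff p q else 0) c c' := by
  rw [formJ, invSq_vecSum d hk, invSq_vecSum d hk, inner_opS_vecSum d hk, inner_vecSum_opS d hk,
    matrixForm_diag_left, matrixForm_diag_right, ← matrixForm_add, ← matrixForm_const_mul]
  congr 3
  funext p q
  split_ifs
  · simp only [coeff, map_pow, map_div₀, map_one, conj_bval]
    ring
  · ring

theorem formP_vecSum [CompleteSpace E] (hk : LinearMap.ker H.toFun = ⊥) (c c' : d.Idx × ℕ →₀ ℂ) :
    d.formP (d.vecSum c) (d.vecSum c') = matrixForm d.coeff c c' := by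
  have hclass : ∀ j, d.formJ j ((d.space j).starProjection (d.vecSum c))
      ((d.space j).starProjection (d.vecSum c')) = c.sum fun p a => if p.1 = j then
        conj a * Finsupp.linearCombination ℂ (d.coeff p) c' else 0 := by
    intro j
    have hm : (fun p q => (if q.1 = j then (1 : ℂ) else 0) *
        (conj (if p.1 = j then (1 : ℂ) else 0) * if p.1 = j then d.coeff p q else 0)) =
        fun p q => if p.1 = j then d.coeff p q else 0 := by
      funext p q
      by_cases hp : p.1 = j
      · by_cases hq : q.1 = j
        · simp [hp, hq]
        · simp [hq, d.coeff_of_ne fun h => hq (h ▸ hp)]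
      · simp [hp]
    rw [starProjection_vecSum, starProjection_vecSum, formJ_vecSum d hk, matrixForm_diag_left,
      matrixForm_diag_right, hm, matrixForm_apply]
    refine Finsupp.sum_congr fun p _ => ?_
    by_cases hp : p.1 = j
    · simp [hp]
    · simp [hp, Finsupp.linearCombination_apply]
  have hsupp : ∀ p ∈ c.support, (Function.support fun j => if p.1 = j then
      conj (c p) * Finsupp.linearCombination ℂ (d.coeff p) c' else 0).Finite := fun p _ =>
    (Set.finite_singleton p.1).subset fun j hj => by_contra fun h => hj (if_neg (Ne.symm h))
  simp only [formP, hclass, Finsupp.sum]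
  rw [finsum_sum_comm _ _ hsupp, matrixForm_apply, Finsupp.sum]
  refine Finset.sum_congr rfl fun p _ => ?_
  rw [finsum_eq_single _ p.1 fun j hj => if_neg hj.symm, if_pos rfl]

end EigenDecomposition

end PointForm

section PointCCR

variable {E : Type*} [NormedAddCommGroup E] [InnerProductSpace ℂ E] {H : E →ₗ.[ℂ] E}

namespace EigenDecomposition

variable (d : EigenDecomposition H)

/-- The vectors `∑ c_p w_p e_p` for which the sum of the `c_p` over each class `j` vanishes: for
`w = F` these are the elements of `H_p 𝓔_p`, for `w = 1 / F` those of `H_p⁻¹ 𝓔_p`. -/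
def weightedCcrP (w : d.Idx × ℕ → ℂ) : Submodule ℂ E :=
  (zeroSum Prod.fst).map (d.vecSum ∘ₗ diag w)

/-- The weights `w` for which `t_p` satisfies the ultra-weak canonical commutation relation on
`weightedCcrP w`. -/
structure IsCCRWeight (w : d.Idx × ℕ → ℂ) : Prop where
  conj_eq : ∀ p, conj (w p) = w p
  exists_add_eq : ∃ u : d.Idx × ℕ → ℂ, ∀ p q,
    w p * w q * (d.bval p / d.bval q + d.bval q / d.bval p) = u p + u q

theorem isCCRWeight_bval (hk : LinearMap.ker H.toFun = ⊥) : d.IsCCRWeight d.bval where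
  conj_eq := d.conj_bval
  exists_add_eq := ⟨fun p => d.bval p ^ 2, fun p q => by
    have hp := d.bval_ne_zero hk p
    have hq := d.bval_ne_zero hk q
    field_simp⟩

theorem isCCRWeight_one_div_bval (hk : LinearMap.ker H.toFun = ⊥) :
    d.IsCCRWeight fun p => 1 / d.bval p where
  conj_eq p := by rw [map_div₀, map_one, conj_bval]
  exists_add_eq := ⟨fun p => (1 / d.bval p) ^ 2, fun p q => by
    have hp := d.bval_ne_zero hk p
    have hq := d.bval_ne_zero hk q
    field_simp
    ring⟩

theorem weightedCcrP_le_domP (w : d.Idx × ℕ → ℂ) : d.weightedCcrP w ≤ d.domP := by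
  rintro _ ⟨c, -, rfl⟩
  exact d.vecSum_mem_domP _

theorem ccrP_le_map_zeroSum : d.ccrP ≤ (zeroSum Prod.fst).map d.vecSum := by
  refine iSup_le fun j => Submodule.span_le.mpr ?_
  rintro _ ⟨n, m, rfl⟩
  refine ⟨.single (j, n) 1 - .single (j, m) 1, ?_, ?_⟩
  · rw [SetLike.mem_coe, zeroSum, LinearMap.mem_ker, map_sub, sub_eq_zero]
    simp only [Finsupp.lmapDomain_apply, Finsupp.mapDomain_single]
  · simp [vecSum_single, bvec]

theorem mapCcrP_le_weightedCcrP : d.mapCcrP ≤ d.weightedCcrP d.bval := by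
  rintro _ ⟨y, hy, rfl⟩
  obtain ⟨c, hc, hcy⟩ := d.ccrP_le_map_zeroSum hy
  exact ⟨c, hc, LinearPMap.mem_graph_snd_inj' H (d.vecSum_mem_graph c) (H.mem_graph y) hcy⟩

theorem invCcrP_le_weightedCcrP (hk : LinearMap.ker H.toFun = ⊥) :
    d.invCcrP ≤ d.weightedCcrP fun p => 1 / d.bval p := by
  rintro _ ⟨⟨x, hx, rfl⟩, -⟩
  obtain ⟨c, hc, hcx⟩ := d.ccrP_le_map_zeroSum hx
  refine ⟨c, hc, eq_of_mem_graph_of_ker_eq_bot hk (y := H x) ?_ (H.mem_graph x)⟩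
  rw [← show d.vecSum c = H x from hcx]
  simpa only [LinearMap.comp_apply, d.diag_bval_diag_one_div_bval hk] using
    d.vecSum_mem_graph (diag (fun p => 1 / d.bval p) c)

theorem bval_sub_mul_coeff (hk : LinearMap.ker H.toFun = ⊥) (p q : d.Idx × ℕ) :
    (d.bval p - d.bval q) * d.coeff p q + Complex.I * (if p = q then 1 else 0) =
      if p.1 = q.1 then Complex.I / 2 * (d.bval p / d.bval q + d.bval q / d.bval p) else 0 := by
  have hp := d.bval_ne_zero hk p
  have hq := d.bval_ne_zero hk q
  by_cases hclass : p.1 = q.1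
  · by_cases hpq : p = q
    · subst hpq
      rw [if_pos rfl, if_pos rfl, div_self hp]
      ring
    · have hne : d.bval p - d.bval q ≠ 0 := sub_ne_zero.mpr fun h => hpq (d.bval_injOn hclass h)
      have hinv : 1 / d.bval p - 1 / d.bval q = -(d.bval p - d.bval q) / (d.bval p * d.bval q) := by
        field_simp
        ring
      rw [if_neg hpq, if_pos hclass, coeff, opEntry, if_pos hclass, hinv]
      field_simp
      ring
  · rw [if_neg hclass, if_neg (mt (congrArg Prod.fst) hclass), d.coeff_of_ne hclass]
    ring

theorem bval_smul_bvec_sub_mem_mapCcrP (j : d.Idx) (n m : ℕ) :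
    d.bval (j, n) • d.bvec (j, n) - d.bval (j, m) • d.bvec (j, m) ∈ d.mapCcrP := by
  have hgraph := H.graph.sub_mem (d.bvec_mem_graph (j, n)) (d.bvec_mem_graph (j, m))
  obtain ⟨hdomain, happly⟩ := mem_graph_iff_exists_apply_eq.mp hgraph
  exact ⟨⟨_, hdomain⟩,
    Submodule.mem_iSup_of_mem j (Submodule.subset_span ⟨n, m, rfl⟩), happly⟩

open Filter Topology in
theorem ppSubspace_le_closure_mapCcrP (hk : LinearMap.ker H.toFun = ⊥) :
    ppSubspace H ≤ d.mapCcrP.topologicalClosure := by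
  rw [← d.span_eq]
  refine Submodule.topologicalClosure_minimal _ (Submodule.span_le.mpr ?_)
    (Submodule.isClosed_topologicalClosure _)
  rintro _ ⟨⟨j, n⟩, rfl⟩
  rw [SetLike.mem_coe, ← Submodule.smul_mem_iff _ (d.bval_ne_zero hk (j, n))]
  have hzero : Tendsto (fun m => d.bval (j, m) • d.bvec (j, m)) atTop (𝓝 0) := by
    rw [tendsto_zero_iff_norm_tendsto_zero]
    simpa only [norm_smul, d.orthonormal_bvec.1, mul_one] using
      tendsto_zero_iff_norm_tendsto_zero.mp (d.tendsto_bval j)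
  have hlim := (tendsto_const_nhds (x := d.bval (j, n) • d.bvec (j, n))).sub hzero
  rw [sub_zero] at hlim
  exact mem_closure_of_tendsto hlim (.of_forall fun m => d.bval_smul_bvec_sub_mem_mapCcrP j n m)

variable [CompleteSpace E]

theorem conj_formP (hk : LinearMap.ker H.toFun = ⊥) {φ ψ : E} (hφ : φ ∈ d.domP)
    (hψ : ψ ∈ d.domP) : conj (d.formP φ ψ) = d.formP ψ φ := by
  obtain ⟨c, rfl⟩ := d.exists_vecSum_of_mem_domP hφ
  obtain ⟨c', rfl⟩ := d.exists_vecSum_of_mem_domP hψ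
  simp only [formP_vecSum d hk, conj_matrixForm, conj_coeff]

theorem isSesquilinear_formP (hk : LinearMap.ker H.toFun = ⊥) :
    IsSesquilinear fun φ ψ : d.domP => d.formP φ ψ := by
  have coord : ∀ φ : d.domP, ∃ c, d.vecSum c = φ := fun φ => d.exists_vecSum_of_mem_domP φ.2
  choose c hc using coord
  constructor
  · intro φ φ' ψ
    simp only [Submodule.coe_add]
    rw [← hc φ, ← hc φ', ← hc ψ, ← map_add]
    simp only [d.formP_vecSum hk]
    rw [map_add, LinearMap.add_apply]
  · intro a φ ψ
    simp only [Submodule.coe_smul]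
    rw [← hc φ, ← hc ψ, ← map_smul]
    simp only [d.formP_vecSum hk]
    rw [map_smulₛₗ, LinearMap.smul_apply, smul_eq_mul]
  · intro φ ψ ψ'
    simp only [Submodule.coe_add]
    rw [← hc φ, ← hc ψ, ← hc ψ', ← map_add]
    simp only [d.formP_vecSum hk]
    rw [map_add]
  · intro a φ ψ
    simp only [Submodule.coe_smul]
    rw [← hc φ, ← hc ψ, ← map_smul]
    simp only [d.formP_vecSum hk]
    rw [map_smul, smul_eq_mul]

theorem formP_vecSum_ccr (hk : LinearMap.ker H.toFun = ⊥) {w : d.Idx × ℕ → ℂ}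
    (hw : d.IsCCRWeight w) {c c' : d.Idx × ℕ →₀ ℂ} (hc : c ∈ zeroSum Prod.fst)
    (hc' : c' ∈ zeroSum Prod.fst) :
    d.formP (d.vecSum (diag d.bval (diag w c))) (d.vecSum (diag w c')) -
      conj (d.formP (d.vecSum (diag d.bval (diag w c'))) (d.vecSum (diag w c))) =
      -(Complex.I * inner ℂ (d.vecSum (diag w c)) (d.vecSum (diag w c'))) := by
  obtain ⟨u, hu⟩ := hw.exists_add_eq
  have hzero := matrixForm_add_eq_zero_of_mem_zeroSum (fun p => Complex.I / 2 * u p) hc hc'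
  have hmatrix : (fun p q : d.Idx × ℕ =>
      if p.1 = q.1 then Complex.I / 2 * u p + Complex.I / 2 * u q else 0) = fun p q =>
      w p * w q * ((d.bval p - d.bval q) * d.coeff p q + Complex.I * if p = q then 1 else 0) := by
    funext p q
    rw [bval_sub_mul_coeff d hk]
    split_ifs
    · linear_combination -(Complex.I / 2) * hu p q
    · ring
  rw [hmatrix] at hzero
  rw [← sub_eq_zero, sub_neg_eq_add, ← hzero, sub_eq_add_neg, ← neg_one_mul]
  simp only [formP_vecSum d hk, inner_vecSum_vecSum, conj_matrixForm, matrixForm_diag_left,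
    matrixForm_diag_right]
  rw [← matrixForm_const_mul, ← matrixForm_const_mul, ← matrixForm_add, ← matrixForm_add]
  congr 3
  funext p q
  simp only [map_mul, conj_coeff, conj_bval, hw.conj_eq]
  ring

theorem formP_ccr (hk : LinearMap.ker H.toFun = ⊥) {w : d.Idx × ℕ → ℂ} (hw : d.IsCCRWeight w)
    {φ ψ φ' ψ' : E} (hφ : φ ∈ d.weightedCcrP w) (hψ : ψ ∈ d.weightedCcrP w)
    (hφ' : (φ, φ') ∈ H.graph) (hψ' : (ψ, ψ') ∈ H.graph) :
    d.formP φ' ψ - conj (d.formP ψ' φ) = -(Complex.I * inner ℂ φ ψ) := by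
  obtain ⟨c, hc, rfl⟩ := hφ
  obtain ⟨c', hc', rfl⟩ := hψ
  obtain rfl := LinearPMap.mem_graph_snd_inj' H (d.vecSum_mem_graph _) hφ' rfl
  obtain rfl := LinearPMap.mem_graph_snd_inj' H (d.vecSum_mem_graph _) hψ' rfl
  exact d.formP_vecSum_ccr hk hw hc hc'

end EigenDecomposition

end PointCCR

section DirectSum

theorem IsCCRDomain.le_domain_left {E : Type*} [NormedAddCommGroup E] [InnerProductSpace ℂ E]
    {A T : E →ₗ.[ℂ] E} {D : Submodule ℂ E} (hD : IsCCRDomain A T D) : D ≤ A.domain :=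
  fun ψ hψ => (hD.2 ψ hψ).choose

theorem IsCCRDomain.le_domain_right {E : Type*} [NormedAddCommGroup E] [InnerProductSpace ℂ E]
    {A T : E →ₗ.[ℂ] E} {D : Submodule ℂ E} (hD : IsCCRDomain A T D) : D ≤ T.domain :=
  fun ψ hψ => (hD.2 ψ hψ).choose_spec.choose

theorem IsCCRDomain.inner_value_sub_conj_inner_value {E : Type*} [NormedAddCommGroup E]
    [InnerProductSpace ℂ E] {A T : E →ₗ.[ℂ] E} {D : Submodule ℂ E} (hD : IsCCRDomain A T D)
    (hA : A.IsFormalAdjoint A) (hT : T.IsFormalAdjoint T) {φ ψ : E} (hφ : φ ∈ D) (hψ : ψ ∈ D) :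
    inner ℂ (value A φ) (value T ψ) - conj (inner ℂ (value A ψ) (value T φ)) =
      -(Complex.I * inner ℂ φ ψ) := by
  obtain ⟨hψA, hψT, hAT, hTA, hcomm⟩ := hD.2 ψ hψ
  have hφA := hD.le_domain_left hφ
  have hφT := hD.le_domain_right hφ
  rw [value_of_mem hφA, value_of_mem hψA, value_of_mem hφT, value_of_mem hψT, inner_conj_symm,
    hA ⟨φ, hφA⟩ ⟨_, hAT⟩, hT ⟨φ, hφT⟩ ⟨_, hTA⟩, ← inner_sub_right, hcomm, inner_neg_right,
    inner_smul_right]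

variable {E : Type*} [NormedAddCommGroup E] [InnerProductSpace ℂ E] {H : E →ₗ.[ℂ] E}

theorem ker_eq_bot_of_zero_notMem_pointSpectrum (h : (0 : ℂ) ∉ pointSpectrum H) :
    LinearMap.ker H.toFun = ⊥ := by
  refine (Submodule.eq_bot_iff _).mpr fun x hx => Subtype.ext ?_
  have hmem : (x : E) ∈ eigenspace H 0 := by
    rw [mem_eigenspace_iff, zero_smul]
    exact mem_graph_iff_exists_apply_eq.mpr ⟨x.2, hx⟩
  rwa [show eigenspace H 0 = ⊥ from not_not.mp h] at hmem

theorem mem_dirSum {A : Submodule ℂ (acSubspace H)} {B : Submodule ℂ E} {x : E} :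
    x ∈ dirSum A B ↔ ∃ (a : A) (b : B), x = a + b := by
  rw [dirSum, Submodule.mem_sup]
  constructor
  · rintro ⟨_, ⟨a, ha, rfl⟩, b, hb, rfl⟩
    exact ⟨⟨a, ha⟩, ⟨b, hb⟩, rfl⟩
  · rintro ⟨a, b, rfl⟩
    exact ⟨_, ⟨a, a.2, rfl⟩, b, b.2, rfl⟩

theorem dirSum_ne_bot {A : Submodule ℂ (acSubspace H)} {B : Submodule ℂ E} (hA : A ≠ ⊥) :
    dirSum A B ≠ ⊥ := by
  have hmap := (Submodule.map_injective_of_injective (acSubspace H).subtype_injective).ne hA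
  rw [Submodule.map_bot] at hmap
  exact ne_bot_of_le_ne_bot hmap le_sup_left

theorem dirSum_mono {A A' : Submodule ℂ (acSubspace H)} {B B' : Submodule ℂ E} (hA : A ≤ A')
    (hB : B ≤ B') : dirSum A B ≤ dirSum A' B' :=
  sup_le_sup (Submodule.map_mono hA) hB

theorem dense_dirSum {A : Submodule ℂ (acSubspace H)} {B : Submodule ℂ E}
    (htop : acSubspace H ⊔ ppSubspace H = ⊤) (hA : Dense (A : Set (acSubspace H)))
    (hB : ppSubspace H ≤ B.topologicalClosure) : Dense (dirSum A B : Set E) := by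
  rw [Submodule.dense_iff_topologicalClosure_eq_top, eq_top_iff, ← htop]
  refine sup_le (fun x hx => ?_) (hB.trans (Submodule.topologicalClosure_mono le_sup_right))
  exact map_mem_closure continuous_subtype_val (hA ⟨x, hx⟩) fun a ha =>
    (le_sup_left : A.map (acSubspace H).subtype ≤ dirSum A B) ⟨a, ha, rfl⟩

variable (d : EigenDecomposition H)

theorem exists_mem_graph_of_mem_dirSum {A : Submodule ℂ (acSubspace H)} {B : Submodule ℂ E}
    (hA : A ≤ (acPart H).domain) (hB : B ≤ d.domP) {φ : E} (hφ : φ ∈ dirSum A B) :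
    ∃ (a : A) (b : B) (b' : d.domP), φ = a + b ∧ ((b : E), (b' : E)) ∈ H.graph ∧
      (φ, ((value (acPart H) a : acSubspace H) : E) + b') ∈ H.graph := by
  obtain ⟨a, b, rfl⟩ := mem_dirSum.mp hφ
  obtain ⟨c, hc⟩ := d.exists_vecSum_of_mem_domP (hB b.2)
  have hb : ((b : E), d.vecSum (diag d.bval c)) ∈ H.graph := by
    rw [← hc]
    exact d.vecSum_mem_graph c
  have ha : ((a : acSubspace H), value (acPart H) a) ∈ (acPart H).graph := by
    rw [value_of_mem (hA a.2)]
    exact (acPart H).mem_graph ⟨a, hA a.2⟩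
  exact ⟨a, b, ⟨_, d.vecSum_mem_domP _⟩, rfl, hb,
    H.graph.add_mem (mem_graph_reducedPart_iff.mp ha) hb⟩

theorem inner_acSubspace_add_ppSubspace (hH : H.IsFormalAdjoint H) (a x : acSubspace H)
    {b y : E} (hb : b ∈ ppSubspace H) (hy : y ∈ ppSubspace H) :
    inner ℂ ((a : E) + b) ((x : E) + y) = inner ℂ a x + inner ℂ b y := by
  have hortho := acSubspace_isOrtho_ppSubspace hH
  rw [inner_add_left, inner_add_right, inner_add_right, hortho.inner_eq a.2 hy,
    hortho.symm.inner_eq hb x.2, Submodule.coe_inner, add_zero, zero_add]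

variable [CompleteSpace E] {d} {T : acSubspace H →ₗ.[ℂ] acSubspace H}

theorem orthogonalProjectionOnto_acSubspace_add (hH : H.IsFormalAdjoint H) (a : acSubspace H)
    {b : E} (hb : b ∈ ppSubspace H) :
    (acSubspace H).orthogonalProjectionOnto ((a : E) + b) = a := by
  have hb' : b ∈ (acSubspace H)ᗮ := (acSubspace_isOrtho_ppSubspace hH).symm.le hb
  rw [map_add, Submodule.orthogonalProjectionOnto_mem_subspace_eq_self,
    Submodule.orthogonalProjectionOnto_eq_zero_iff.mpr hb', add_zero]

theorem starProjection_ppSubspace_add (hH : H.IsFormalAdjoint H) (a : acSubspace H)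
    {b : E} (hb : b ∈ ppSubspace H) :
    (ppSubspace H).starProjection ((a : E) + b) = b := by
  have ha : (a : E) ∈ (ppSubspace H)ᗮ := (acSubspace_isOrtho_ppSubspace hH).le a.2
  rw [map_add, Submodule.starProjection_eq_self_iff.mpr hb,
    (Submodule.starProjection_apply_eq_zero_iff _).mpr ha, zero_add]

theorem formH_apply (hH : H.IsFormalAdjoint H)
    (φ : dirSum (⊤ : Submodule ℂ (acSubspace H)) d.domP) (ψ : dirSum T.domain d.domP)
    (φ₁ : acSubspace H) (ψ₁ : T.domain) (φ₂ ψ₂ : d.domP)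
    (hφ : (φ : E) = φ₁ + φ₂) (hψ : (ψ : E) = (ψ₁ : acSubspace H) + ψ₂) :
    formH T d φ ψ = inner ℂ φ₁ (T ψ₁) + d.formP φ₂ ψ₂ := by
  have hφ₂ := d.domP_le_ppSubspace φ₂.2
  have hψ₂ := d.domP_le_ppSubspace ψ₂.2
  rw [formH, hφ, hψ, orthogonalProjectionOnto_acSubspace_add hH _ hφ₂,
    orthogonalProjectionOnto_acSubspace_add hH _ hψ₂, starProjection_ppSubspace_add hH _ hφ₂,
    starProjection_ppSubspace_add hH _ hψ₂, value_of_mem ψ₁.2]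

theorem formH_add_left (hH : H.IsFormalAdjoint H) (hk : LinearMap.ker H.toFun = ⊥)
    (φ φ' : dirSum (⊤ : Submodule ℂ (acSubspace H)) d.domP) (ψ : dirSum T.domain d.domP) :
    formH T d (φ + φ') ψ = formH T d φ ψ + formH T d φ' ψ := by
  obtain ⟨a, b, hφ⟩ := mem_dirSum.mp φ.2
  obtain ⟨a', b', hφ'⟩ := mem_dirSum.mp φ'.2
  obtain ⟨x, y, hψ⟩ := mem_dirSum.mp ψ.2
  have hadd : ((φ + φ' : dirSum _ _) : E) = (a + a' : acSubspace H) + (b + b' : d.domP) := by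
    rw [Submodule.coe_add, hφ, hφ', Submodule.coe_add, Submodule.coe_add, add_add_add_comm]
  rw [formH_apply hH _ _ _ x _ y hadd hψ, formH_apply hH _ _ _ x _ y hφ hψ,
    formH_apply hH _ _ _ x _ y hφ' hψ, inner_add_left,
    (d.isSesquilinear_formP hk).add_left, add_add_add_comm]

theorem formH_smul_left (hH : H.IsFormalAdjoint H) (hk : LinearMap.ker H.toFun = ⊥)
    (k : ℂ) (φ : dirSum (⊤ : Submodule ℂ (acSubspace H)) d.domP) (ψ : dirSum T.domain d.domP) :
    formH T d (k • φ) ψ = conj k * formH T d φ ψ := by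
  obtain ⟨a, b, hφ⟩ := mem_dirSum.mp φ.2
  obtain ⟨x, y, hψ⟩ := mem_dirSum.mp ψ.2
  have hsmul : ((k • φ : dirSum _ _) : E) = (k • a : acSubspace H) + (k • b : d.domP) := by
    rw [Submodule.coe_smul, hφ, smul_add, Submodule.coe_smul, Submodule.coe_smul]
  rw [formH_apply hH _ _ _ x _ y hsmul hψ, formH_apply hH _ _ _ x _ y hφ hψ, inner_smul_left,
    (d.isSesquilinear_formP hk).smul_left, mul_add]

theorem formH_add_right (hH : H.IsFormalAdjoint H) (hk : LinearMap.ker H.toFun = ⊥)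
    (φ : dirSum (⊤ : Submodule ℂ (acSubspace H)) d.domP) (ψ ψ' : dirSum T.domain d.domP) :
    formH T d φ (ψ + ψ') = formH T d φ ψ + formH T d φ ψ' := by
  obtain ⟨a, b, hφ⟩ := mem_dirSum.mp φ.2
  obtain ⟨x, y, hψ⟩ := mem_dirSum.mp ψ.2
  obtain ⟨x', y', hψ'⟩ := mem_dirSum.mp ψ'.2
  have hadd : ((ψ + ψ' : dirSum _ _) : E) =
      ((x + x' : T.domain) : acSubspace H) + (y + y' : d.domP) := by
    rw [Submodule.coe_add, hψ, hψ', Submodule.coe_add, Submodule.coe_add, Submodule.coe_add,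
      add_add_add_comm]
  rw [formH_apply hH _ _ a _ b _ hφ hadd, formH_apply hH _ _ a _ b _ hφ hψ,
    formH_apply hH _ _ a _ b _ hφ hψ', LinearPMap.map_add, inner_add_right,
    (d.isSesquilinear_formP hk).add_right, add_add_add_comm]

theorem formH_smul_right (hH : H.IsFormalAdjoint H) (hk : LinearMap.ker H.toFun = ⊥)
    (k : ℂ) (φ : dirSum (⊤ : Submodule ℂ (acSubspace H)) d.domP) (ψ : dirSum T.domain d.domP) :
    formH T d φ (k • ψ) = k * formH T d φ ψ := by
  obtain ⟨a, b, hφ⟩ := mem_dirSum.mp φ.2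
  obtain ⟨x, y, hψ⟩ := mem_dirSum.mp ψ.2
  have hsmul : ((k • ψ : dirSum _ _) : E) =
      ((k • x : T.domain) : acSubspace H) + (k • y : d.domP) := by
    rw [Submodule.coe_smul, hψ, smul_add, Submodule.coe_smul, Submodule.coe_smul,
      Submodule.coe_smul]
  rw [formH_apply hH _ _ a _ b _ hφ hsmul, formH_apply hH _ _ a _ b _ hφ hψ,
    LinearPMap.map_smul, inner_smul_right, (d.isSesquilinear_formP hk).smul_right, mul_add]

theorem isSesquilinear_formH (hH : H.IsFormalAdjoint H) (hk : LinearMap.ker H.toFun = ⊥) :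
    IsSesquilinear (formH T d) :=
  ⟨formH_add_left hH hk, formH_smul_left hH hk, formH_add_right hH hk, formH_smul_right hH hk⟩

theorem conj_formH (hH : H.IsFormalAdjoint H) (hk : LinearMap.ker H.toFun = ⊥)
    (hT : T.IsFormalAdjoint T) (φ ψ : dirSum T.domain d.domP) :
    conj (formH T d ⟨φ, dirSum_mono le_top le_rfl φ.2⟩ ψ) =
      formH T d ⟨ψ, dirSum_mono le_top le_rfl ψ.2⟩ φ := by
  obtain ⟨a, b, hφ⟩ := mem_dirSum.mp φ.2
  obtain ⟨x, y, hψ⟩ := mem_dirSum.mp ψ.2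
  rw [formH_apply hH _ _ a x b y hφ hψ, formH_apply hH _ _ x a y b hψ hφ, map_add,
    d.conj_formP hk b.2 y.2, inner_conj_symm, hT]

theorem formH_ccr (hH : H.IsFormalAdjoint H) (hk : LinearMap.ker H.toFun = ⊥)
    (hT : T.IsFormalAdjoint T) {D : Submodule ℂ (acSubspace H)}
    (hD : IsCCRDomain (acPart H) T D) {w : d.Idx × ℕ → ℂ} (hw : d.IsCCRWeight w)
    {φ ψ : dirSum T.domain d.domP} {φ' ψ' : dirSum (⊤ : Submodule ℂ (acSubspace H)) d.domP}
    (hφ : (φ : E) ∈ dirSum D (d.weightedCcrP w)) (hψ : (ψ : E) ∈ dirSum D (d.weightedCcrP w))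
    (hφ' : ((φ : E), (φ' : E)) ∈ H.graph) (hψ' : ((ψ : E), (ψ' : E)) ∈ H.graph) :
    formH T d φ' ψ - conj (formH T d ψ' φ) = -(Complex.I * inner ℂ (φ : E) ψ) := by
  have hle := d.weightedCcrP_le_domP w
  obtain ⟨a, b, b', hab, hb, hHφ⟩ := exists_mem_graph_of_mem_dirSum d hD.le_domain_left hle hφ
  obtain ⟨x, y, y', hxy, hy, hHψ⟩ := exists_mem_graph_of_mem_dirSum d hD.le_domain_left hle hψ
  have hac := hD.inner_value_sub_conj_inner_value (reducedPart_isFormalAdjoint hH _) hT a.2 x.2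
  have hpp := d.formP_ccr hk hw b.2 y.2 hb hy
  have haT := hD.le_domain_right a.2
  have hxT := hD.le_domain_right x.2
  rw [value_of_mem haT, value_of_mem hxT] at hac
  rw [formH_apply hH φ' ψ _ ⟨x, hxT⟩ b' ⟨y, hle y.2⟩
      (LinearPMap.mem_graph_snd_inj' H hφ' hHφ rfl) hxy,
    formH_apply hH ψ' φ _ ⟨a, haT⟩ y' ⟨b, hle b.2⟩
      (LinearPMap.mem_graph_snd_inj' H hψ' hHψ rfl) hab, map_add, hab, hxy,
    inner_acSubspace_add_ppSubspace hH _ _ (d.domP_le_ppSubspace (hle b.2))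
      (d.domP_le_ppSubspace (hle y.2))]
  linear_combination hac + hpp

theorem isUltraWeakCCRDomain_dirSum (hH : H.IsFormalAdjoint H) (hk : LinearMap.ker H.toFun = ⊥)
    (hT : T.IsFormalAdjoint T) {D : Submodule ℂ (acSubspace H)}
    (hD : IsCCRDomain (acPart H) T D) {w : d.Idx × ℕ → ℂ} (hw : d.IsCCRWeight w)
    {B : Submodule ℂ E} (hB : B ≤ d.weightedCcrP w) :
    IsUltraWeakCCRDomain H (formH T d) (dirSum D B) := by
  have hBP := hB.trans (d.weightedCcrP_le_domP w)
  have happly : ∀ φ ∈ dirSum D B, ∃ h : φ ∈ H.domain, H ⟨φ, h⟩ ∈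
      dirSum (⊤ : Submodule ℂ (acSubspace H)) d.domP := by
    intro φ hφ
    obtain ⟨a, b, b', -, -, hgraph⟩ := exists_mem_graph_of_mem_dirSum d hD.le_domain_left hBP hφ
    obtain ⟨h, hHφ⟩ := mem_graph_iff_exists_apply_eq.mp hgraph
    exact ⟨h, mem_dirSum.mpr ⟨⟨_, Submodule.mem_top⟩, b', hHφ⟩⟩
  exact
    ⟨dirSum T.domain d.domP,
      { ne_bot := dirSum_ne_bot hD.1
        symm_ne_bot := dirSum_ne_bot (ne_bot_of_le_ne_bot hD.1 hD.le_domain_right)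
        symm_le_left := dirSum_mono le_top le_rfl
        symm_le_right := le_rfl
        le_symm := dirSum_mono hD.le_domain_right hBP
        le_domain := fun φ hφ => (happly φ hφ).choose
        map_mem := fun φ hφ => (happly φ hφ).choose_spec
        symm := fun φ ψ hφ hψ => conj_formH hH hk hT ⟨φ, hφ⟩ ⟨ψ, hψ⟩
        ccr := fun φ ψ hφ hψ => formH_ccr hH hk hT hD hw (dirSum_mono le_rfl hB hφ)
          (dirSum_mono le_rfl hB hψ) (H.mem_graph ⟨φ, (happly φ hφ).choose⟩)
          (H.mem_graph ⟨ψ, (happly ψ hψ).choose⟩) }⟩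

theorem isUltraWeakTimeOperator_formH (hH : H.IsFormalAdjoint H)
    (hk : LinearMap.ker H.toFun = ⊥) (hT : T.IsFormalAdjoint T)
    {D : Submodule ℂ (acSubspace H)} (hD : IsCCRDomain (acPart H) T D) :
    IsUltraWeakTimeOperator H (formH T d) :=
  ⟨dirSum_ne_bot (ne_bot_of_le_ne_bot hD.1 le_top),
    dirSum_ne_bot (ne_bot_of_le_ne_bot hD.1 hD.le_domain_right), isSesquilinear_formH hH hk, _,
    isUltraWeakCCRDomain_dirSum hH hk hT hD (d.isCCRWeight_bval hk) le_rfl⟩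

end DirectSum

section ClassS1

variable {E : Type*} [NormedAddCommGroup E] [InnerProductSpace ℂ E] [CompleteSpace E]
  {H : E →ₗ.[ℂ] E}

theorem acSubspace_sup_ppSubspace (hH : IsSelfAdjoint H) (hsc : spectrum (scPart H) = ∅) :
    acSubspace H ⊔ ppSubspace H = ⊤ := by
  have htop := acSubspace_sup_scSubspace_sup_ppSubspace hH
  rwa [scSubspace_eq_bot (isFormalAdjoint_of_isSelfAdjoint hH) hsc, sup_bot_eq] at htop

theorem ClassS1.nontrivial_acSubspace (hH : ClassS1 H) : Nontrivial (acSubspace H) := by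
  refine nontrivial_of_spectrum_nonempty (A := acPart H) ?_
  rw [hH.ac_eq]
  exact Set.nonempty_Ici.image _

theorem ClassS1.finiteDimensional_eigenspace (hH : ClassS1 H) {z : ℂ}
    (hz : z ∈ pointSpectrum H) : FiniteDimensional ℂ (eigenspace H z) := by
  rw [← hH.disc_eq] at hz
  exact hz.2.1

end ClassS1

end TimeOperator

end

theorem theorem5_general {ℋ : Type*} [NormedAddCommGroup ℋ] [InnerProductSpace ℂ ℋ]
    [CompleteSpace ℋ] (H : ℋ →ₗ.[ℂ] ℋ) (hH : IsSelfAdjoint H)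
    (hsc : TimeOperator.spectrum (TimeOperator.scPart H) = ∅)
    (hac : Nontrivial (TimeOperator.acSubspace H)) {e : ℕ → ℝ}
    (hpoint : TimeOperator.pointSpectrum H = Set.range fun n => (e n : ℂ))
    (hinj : Function.Injective e) (hne : ∀ n, e n ≠ 0)
    (hlim : Filter.Tendsto e Filter.atTop (nhds 0))
    (hfin : ∀ n, FiniteDimensional ℂ (TimeOperator.eigenspace H (e n)))
    (htime : ∃ T, TimeOperator.IsStrongTimeOperator (TimeOperator.acPart H) T) :
    (∃ T : TimeOperator.acSubspace H →ₗ.[ℂ] TimeOperator.acSubspace H,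
      TimeOperator.IsStrongTimeOperator (TimeOperator.acPart H) T ∧ T.IsClosed) ∧
    (∀ T : TimeOperator.acSubspace H →ₗ.[ℂ] TimeOperator.acSubspace H,
      TimeOperator.IsStrongTimeOperator (TimeOperator.acPart H) T → T.IsClosed →
      ∃ Dac : Submodule ℂ (TimeOperator.acSubspace H),
        TimeOperator.IsCCRDomain (TimeOperator.acPart H) T Dac ∧
        Dense (Dac : Set (TimeOperator.acSubspace H))) ∧
    Nonempty (TimeOperator.EigenDecomposition H) ∧
    (∀ T : TimeOperator.acSubspace H →ₗ.[ℂ] TimeOperator.acSubspace H,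
      TimeOperator.IsStrongTimeOperator (TimeOperator.acPart H) T →
      ∀ Dac : Submodule ℂ (TimeOperator.acSubspace H),
        TimeOperator.IsCCRDomain (TimeOperator.acPart H) T Dac →
        Dense (Dac : Set (TimeOperator.acSubspace H)) →
      ∀ d : TimeOperator.EigenDecomposition H,
        (∀ (φ : TimeOperator.dirSum ⊤ d.domP) (ψ : TimeOperator.dirSum T.domain d.domP)
            (φ₁ : TimeOperator.acSubspace H) (ψ₁ : T.domain) (φ₂ ψ₂ : d.domP),
          (φ : ℋ) = (φ₁ : ℋ) + (φ₂ : ℋ) →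
          (ψ : ℋ) = ((ψ₁ : TimeOperator.acSubspace H) : ℋ) + (ψ₂ : ℋ) →
          TimeOperator.formH T d φ ψ = inner ℂ φ₁ (T ψ₁) + d.formP φ₂ ψ₂) ∧
        TimeOperator.IsUltraWeakTimeOperator H (TimeOperator.formH T d) ∧
        TimeOperator.IsUltraWeakCCRDomain H (TimeOperator.formH T d)
          (TimeOperator.dirSum Dac d.invCcrP) ∧
        TimeOperator.IsUltraWeakCCRDomain H (TimeOperator.formH T d)
          (TimeOperator.dirSum Dac d.mapCcrP) ∧
        Dense (TimeOperator.dirSum Dac d.mapCcrP : Set ℋ)) := by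
  have hs := TimeOperator.isFormalAdjoint_of_isSelfAdjoint hH
  have hk : LinearMap.ker H.toFun = ⊥ := by
    refine TimeOperator.ker_eq_bot_of_zero_notMem_pointSpectrum ?_
    rw [hpoint]
    rintro ⟨n, hn⟩
    exact hne n (Complex.ofReal_eq_zero.mp hn)
  refine ⟨htime.elim fun T hT => hT.exists_isClosed,
    fun T hT hcl => hT.exists_dense_isCCRDomain hcl,
    TimeOperator.nonempty_eigenDecomposition hs hpoint hinj hlim hfin, ?_⟩
  intro T hT Dac hD hdense d
  have hsymm := hT.2.1.2
  exact
    ⟨TimeOperator.formH_apply hs, TimeOperator.isUltraWeakTimeOperator_formH hs hk hsymm hD,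
      TimeOperator.isUltraWeakCCRDomain_dirSum hs hk hsymm hD (d.isCCRWeight_one_div_bval hk)
        (d.invCcrP_le_weightedCcrP hk),
      TimeOperator.isUltraWeakCCRDomain_dirSum hs hk hsymm hD (d.isCCRWeight_bval hk)
        d.mapCcrP_le_weightedCcrP,
      TimeOperator.dense_dirSum (TimeOperator.acSubspace_sup_ppSubspace hH hsc) hdense
        (d.ppSubspace_le_closure_mapCcrP hk)⟩

theorem theorem5 {ℋ : Type*} [NormedAddCommGroup ℋ] [InnerProductSpace ℂ ℋ] [CompleteSpace ℋ]
    (H : ℋ →ₗ.[ℂ] ℋ) (hH : TimeOperator.ClassS1 H) :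
    -- the objects from which the form is built exist
    (∃ T : TimeOperator.acSubspace H →ₗ.[ℂ] TimeOperator.acSubspace H,
      TimeOperator.IsStrongTimeOperator (TimeOperator.acPart H) T ∧ T.IsClosed) ∧
    (∀ T : TimeOperator.acSubspace H →ₗ.[ℂ] TimeOperator.acSubspace H,
      TimeOperator.IsStrongTimeOperator (TimeOperator.acPart H) T → T.IsClosed →
      ∃ Dac : Submodule ℂ (TimeOperator.acSubspace H),
        TimeOperator.IsCCRDomain (TimeOperator.acPart H) T Dac ∧
        Dense (Dac : Set (TimeOperator.acSubspace H))) ∧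
    Nonempty (TimeOperator.EigenDecomposition H) ∧
    -- and for every choice of them
    (∀ T : TimeOperator.acSubspace H →ₗ.[ℂ] TimeOperator.acSubspace H,
      TimeOperator.IsStrongTimeOperator (TimeOperator.acPart H) T →
      ∀ Dac : Submodule ℂ (TimeOperator.acSubspace H),
        TimeOperator.IsCCRDomain (TimeOperator.acPart H) T Dac →
        Dense (Dac : Set (TimeOperator.acSubspace H)) →
      ∀ d : TimeOperator.EigenDecomposition H,
        -- `t_H[φ₁ + φ₂, ψ₁ + ψ₂] = (φ₁, T ψ₁) + t_p[φ₂, ψ₂]`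
        (∀ (φ : TimeOperator.dirSum ⊤ d.domP) (ψ : TimeOperator.dirSum T.domain d.domP)
            (φ₁ : TimeOperator.acSubspace H) (ψ₁ : T.domain) (φ₂ ψ₂ : d.domP),
          (φ : ℋ) = (φ₁ : ℋ) + (φ₂ : ℋ) →
          (ψ : ℋ) = ((ψ₁ : TimeOperator.acSubspace H) : ℋ) + (ψ₂ : ℋ) →
          TimeOperator.formH T d φ ψ = inner ℂ φ₁ (T ψ₁) + d.formP φ₂ ψ₂) ∧
        TimeOperator.IsUltraWeakTimeOperator H (TimeOperator.formH T d) ∧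
        TimeOperator.IsUltraWeakCCRDomain H (TimeOperator.formH T d)
          (TimeOperator.dirSum Dac d.invCcrP) ∧
        TimeOperator.IsUltraWeakCCRDomain H (TimeOperator.formH T d)
          (TimeOperator.dirSum Dac d.mapCcrP) ∧
        Dense (TimeOperator.dirSum Dac d.mapCcrP : Set ℋ)) := by
  obtain ⟨e, hpoint, hmono, hneg, hlim⟩ := hH.point_eq
  exact theorem5_general H hH.selfAdjoint hH.sc_empty hH.nontrivial_acSubspace hpoint
    hmono.injective (fun n => (hneg n).ne) hlim
    (fun n => hH.finiteDimensional_eigenspace (hpoint ▸ ⟨n, rfl⟩)) hH.exists_time
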